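/- A rooted tree is a finite tree with a distinguished vertex (the root); $\mathbb T$ denotes the set of isomorphism classes of rooted trees, and $|t|$ the number of vertices of $t$. If $e$ is an edge of $t$, then deleting $e$ splits $t$ into two rooted trees: $R_e(t)$, which contains the root of $t$, and $P_e(t)$, the other one, rooted at its end of $e$. For a vertex $v$ of $s$, let $s\cup_v t$ be the tree obtained by joining the root of $t$ to $v$ by a new edge, with the root of $s$ as root. For $t_1,t_2,t_3\in\mathbb T$ let $$\alpha(t_1,t_2,t_3)=|\{e\in E(t_2) : R_e(t_2)=t_3,\ P_e(t_2)=t_1\}|,\qquad \beta(t_1,t_2,t_3)=|\{v\in V(t_3): t_1=t_3\cup_v t_2\}|.$$ The insertion-elimination algebra $\mathfrak g$ is the complex Lie algebra with basis $\{d\}\cup\{D_t^+,D_t^-: t\in\mathbb T\}$ and brackets $$[D_s^+,D_t^+]=\sum_{r\in\mathbb T}(\beta(r,s,t)-\beta(r,t,s))D_r^+,\qquad [D_s^-,D_t^-]=\sum_{r\in\mathbb T}(\alpha(t,r,s)-\alpha(s,r,t))D_r^-,$$ $$[D_s^-,D_t^+]=\sum_{r\in\mathbb T}\alpha(s,t,r)D_r^+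 +\sum_{r\in\mathbb T}\beta(s,t,r)D_r^-\ (s\ne t),\qquad [D_t^-,D_t^+]=d,\qquad [d,D_t^{\pm}]=\pm|t|D_t^{\pm}.$$ For $n\in\mathbb Z$ let $\mathfrak g_n=\{x\in\mathfrak g : [d,x]=nx\}$. Let $\mathfrak s$ be a finite-dimensional Lie subalgebra of $\mathfrak g$. Then either $\dim\mathfrak s\le 2$, or $\dim\mathfrak s=3$ and there are integers $m,n>0$ and elements $x\in\mathfrak g_m$, $y\in\mathfrak g_{-n}$ with $\mathfrak s=\mathbb C x\oplus\mathbb C d\oplus\mathbb C y$. Moreover, suppose that $\dim \mathfrak s=3$ and let $m,n,x,y$ be as above (that is, $m,n>0$, and $x,d,y$ are linearly independent and span $\mathfrak s$). If $[x,y]=0$, then $[\mathfrak s,\mathfrak s]=\mathbb C x\oplus\mathbb C y$ is 2-dimensional. If $[x,y]\neq 0$, then $m=n$ and $\mathfrak s\cong\mathfrak{sl}_2(\mathbb C)$. Furthermore, $\mathfrak g$ contains an abelian Lie subalgebra of dimension 2 and a non-abelian Lie subalgebra of dimension 2. If $t$ is the tree with two vertices and $u$ is the tree with three vertices whose root is adjacent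 to both other vertices, then $[D_t^+,D_u^-]=0$, and the span of $D_t^+,d,D_u^-$ is a 3-dimensional Lie subalgebra of $\mathfrak g$. -/

import Mathlib

noncomputable section

namespace InsElim

/-- A finite rooted tree whose children at each vertex are listed in some order: a root together
with the `n` trees hanging from it. The order is forgotten below, in `RTree`. -/
inductive PTree : Type
  | node (n : ℕ) (c : Fin n → PTree) : PTree

namespace PTree

/-- Isomorphism of rooted trees: a bijection between the children of the two roots under which the
trees hanging from corresponding children are isomorphic. -/
inductive Iso : PTree → PTree → Prop
  | node {n m : ℕ} {c : Fin n → PTree} {c' : Fin m → PTree} (σ : Fin n ≃ Fin m)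
      (h : ∀ i, Iso (c i) (c' (σ i))) : Iso (node n c) (node m c')

theorem Iso.refl : ∀ t : PTree, Iso t t
  | .node _ c => .node (Equiv.refl _) fun i => Iso.refl (c i)

theorem Iso.symm {s t : PTree} (h : Iso s t) : Iso t s := by
  induction h with
  | @node n m c c' σ h ih =>
    exact .node σ.symm fun i => by simpa using ih (σ.symm i)

theorem Iso.trans {s t : PTree} (h : Iso s t) : ∀ {u : PTree}, Iso t u → Iso s u := by
  induction h with
  | node σ h ih =>
    intro u hu
    cases hu with
    | node τ h' => exact .node (σ.trans τ) fun i => ih i (h' (σ i))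

instance setoid : Setoid PTree := ⟨Iso, Iso.refl, Iso.symm, fun h k => h.trans k⟩

/-- The vertices of a tree: the root, and the vertices of the trees hanging from it. -/
inductive Vertex : PTree → Type
  | root {n : ℕ} {c : Fin n → PTree} : Vertex (node n c)
  | child {n : ℕ} {c : Fin n → PTree} (i : Fin n) (v : Vertex (c i)) : Vertex (node n c)

/-- The edges of a tree: those joining the root to its children, and the edges of the trees
hanging from the root. -/
inductive Edge : PTree → Type
  | atRoot {n : ℕ} {c : Fin n → PTree} (i : Fin n) : Edge (node n c)
  | inChild {n : ℕ} {c : Fin n → PTree} (i : Fin n) (e : Edge (c i)) : Edge (node n c)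

/-- `graft v t` is the tree `s ∪_v t`: the root of `t` is joined by a new edge to the vertex `v`
of `s`, and the root is that of `s`. -/
def graft : {s : PTree} → Vertex s → PTree → PTree
  | _, @Vertex.root n c, t => node (n + 1) (Fin.cons t c)
  | _, @Vertex.child n c i v, t => node n (Function.update c i (graft v t))

/-- Delete the `i`-th child of the root, together with the tree hanging from it. -/
def eraseChild : {n : ℕ} → (Fin n → PTree) → Fin n → PTree
  | n + 1, c, i => node n fun j => c (i.succAbove j)

/-- `cutOff e` is the tree `P_e(t)`: when the edge `e` is deleted, the component that does not
contain the root of `t`, rooted at its end of `e`. -/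
def cutOff : {t : PTree} → Edge t → PTree
  | _, @Edge.atRoot _ c i => c i
  | _, @Edge.inChild _ _ _ e => cutOff e

/-- `keep e` is the tree `R_e(t)`: when the edge `e` is deleted, the component that contains the
root of `t`. -/
def keep : {t : PTree} → Edge t → PTree
  | _, @Edge.atRoot _ c i => eraseChild c i
  | _, @Edge.inChild n c i e => node n (Function.update c i (keep e))

end PTree

/-- The set `𝕋` of isomorphism classes of rooted trees. -/
def RTree : Type := Quotient PTree.setoid

namespace RTree

/-- The isomorphism class of a tree. -/
def mk (t : PTree) : RTree := Quotient.mk PTree.setoid t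

/-- A representative of an isomorphism class. -/
def rep (t : RTree) : PTree := Quotient.out t

/-- The number `|t|` of vertices. -/
def size (t : RTree) : ℕ := Nat.card t.rep.Vertex

/-- `α(t₁, t₂, t₃)`: the number of edges `e` of `t₂` with `R_e(t₂) = t₃` and `P_e(t₂) = t₁`. -/
def alpha (t₁ t₂ t₃ : RTree) : ℕ :=
  {e : t₂.rep.Edge | mk (PTree.keep e) = t₃ ∧ mk (PTree.cutOff e) = t₁}.ncard

/-- `β(t₁, t₂, t₃)`: the number of vertices `v` of `t₃` with `t₁ = t₃ ∪_v t₂`. -/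
def beta (t₁ t₂ t₃ : RTree) : ℕ :=
  {v : t₃.rep.Vertex | t₁ = mk (PTree.graft v t₂.rep)}.ncard

end RTree

/-- Labels of the basis of the insertion-elimination algebra. -/
inductive Idx : Type
  | d : Idx
  | plus (t : RTree) : Idx
  | minus (t : RTree) : Idx

/-- The complex vector space with basis `d`, `D⁺_t`, `D⁻_t` (`t ∈ 𝕋`) that underlies the
insertion-elimination algebra. -/
def Alg : Type := Idx →₀ ℂ

instance : AddCommGroup Alg := inferInstanceAs (AddCommGroup (Idx →₀ ℂ))
instance : Module ℂ Alg := inferInstanceAs (Module ℂ (Idx →₀ ℂ))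

/-- The defining basis. -/
def basis : Module.Basis Idx ℂ Alg := Finsupp.basisSingleOne

/-- The element `d`. -/
def d : Alg := basis Idx.d
/-- The element `D⁺_t`. -/
def Dp (t : RTree) : Alg := basis (Idx.plus t)
/-- The element `D⁻_t`. -/
def Dm (t : RTree) : Alg := basis (Idx.minus t)

open RTree in
/-- The bracket of `D⁻_s` with `D⁺_t`: it is `d` for `s = t`, and the displayed sum for `s ≠ t`.
(For `s = t` all the coefficients of the sum vanish, see `alpha_self` and `beta_self`.) -/
def brMinusPlus (s t : RTree) : Alg :=
  open scoped Classical in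
  if s = t then d
  else ∑ᶠ r, (alpha s t r : ℂ) • Dp r + ∑ᶠ r, (beta s t r : ℂ) • Dm r

open RTree in
/-- The brackets of the basis vectors. All the sums have finite support, see `beta_fin`, `beta_fin'`,
`alpha_fin` and `alpha_fin'`. -/
def br : Idx → Idx → Alg
  | .plus s, .plus t => ∑ᶠ r, ((beta r s t : ℂ) - (beta r t s : ℂ)) • Dp r
  | .minus s, .minus t => ∑ᶠ r, ((alpha t r s : ℂ) - (alpha s r t : ℂ)) • Dm r
  | .minus s, .plus t => brMinusPlus s t
  | .plus t, .minus s => -brMinusPlus s t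
  | .d, .d => 0
  | .d, .minus t => -(size t : ℂ) • Dm t
  | .minus t, .d => (size t : ℂ) • Dm t
  | .d, .plus t => (size t : ℂ) • Dp t
  | .plus t, .d => -(size t : ℂ) • Dp t

/-- The bilinear extension of `br`. -/
def brLin : Alg →ₗ[ℂ] Alg →ₗ[ℂ] Alg :=
  basis.constr ℂ fun i => basis.constr ℂ fun j => br i j


/-! ### Proof of the Jacobi identity

The basis vectors act faithfully by derivations on the polynomial ring on `𝕋`, compatibly with the
bracket. Nothing in this part is used in later definitions, except the resulting identities. -/

section Jacobi

open PTree RTree MvPolynomial Finset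

namespace PTree

def vertexEquiv {n : ℕ} (c : Fin n → PTree) :
    Vertex (node n c) ≃ Option (Σ i, Vertex (c i)) where
  toFun
    | .root => none
    | .child i v => some ⟨i, v⟩
  invFun
    | none => .root
    | some ⟨i, v⟩ => .child i v
  left_inv v := by cases v <;> rfl
  right_inv v := by rcases v with _ | ⟨i, v⟩ <;> rfl

def edgeEquiv {n : ℕ} (c : Fin n → PTree) :
    Edge (node n c) ≃ Fin n ⊕ (Σ i, Edge (c i)) where
  toFun
    | .atRoot i => .inl i
    | .inChild i e => .inr ⟨i, e⟩
  invFun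
    | .inl i => .atRoot i
    | .inr ⟨i, e⟩ => .inChild i e
  left_inv v := by cases v <;> rfl
  right_inv v := by rcases v with _ | ⟨i, v⟩ <;> rfl

instance finiteVertex : ∀ t : PTree, Finite t.Vertex
  | .node _ c => by
    have := fun i => finiteVertex (c i)
    exact Finite.of_equiv _ (vertexEquiv c).symm

instance finiteEdge : ∀ t : PTree, Finite t.Edge
  | .node _ c => by
    have := fun i => finiteEdge (c i)
    exact Finite.of_equiv _ (edgeEquiv c).symm

instance (t : PTree) : Fintype t.Vertex := Fintype.ofFinite _
instance (t : PTree) : Fintype t.Edge := Fintype.ofFinite _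

theorem sum_vertex {M : Type*} [AddCommMonoid M] {n : ℕ} (c : Fin n → PTree)
    (f : Vertex (node n c) → M) :
    ∑ v, f v = f .root + ∑ i, ∑ v : Vertex (c i), f (.child i v) := by
  rw [← (vertexEquiv c).symm.sum_comp, Fintype.sum_option, Fintype.sum_sigma]
  rfl

theorem sum_edge {M : Type*} [AddCommMonoid M] {n : ℕ} (c : Fin n → PTree)
    (f : Edge (node n c) → M) :
    ∑ v, f v = ∑ i, f (.atRoot i) + ∑ i, ∑ v : Edge (c i), f (.inChild i v) := by
  rw [← (edgeEquiv c).symm.sum_comp, Fintype.sum_sum_type, Fintype.sum_sigma]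
  rfl

/-- The number of vertices. -/
def sz (t : PTree) : ℕ := Nat.card t.Vertex

theorem sz_node {n : ℕ} (c : Fin n → PTree) : sz (node n c) = 1 + ∑ i, sz (c i) := by
  have := sum_vertex c (fun _ => (1 : ℕ))
  simpa [sz, Nat.card_eq_fintype_card] using this

theorem Iso.sz_eq {s t : PTree} (h : Iso s t) : sz s = sz t := by
  induction h with
  | node σ h ih =>
    rw [sz_node, sz_node, ← σ.sum_comp]
    simp [ih]

/-- The children of the root, as a formal sum of isomorphism classes. -/
def kids : PTree → (RTree →₀ ℕ)
  | .node _ c => ∑ i, Finsupp.single (RTree.mk (c i)) 1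

end PTree

namespace RTree

theorem mk_eq {s t : PTree} : mk s = mk t ↔ Iso s t := Quotient.eq (r := PTree.setoid)

@[simp] theorem mk_rep (t : RTree) : mk t.rep = t := Quotient.out_eq (s := PTree.setoid) t

theorem iso_rep (t : PTree) : Iso (mk t).rep t := mk_eq.1 (mk_rep _)

theorem size_mk (t : PTree) : size (mk t) = sz t := (iso_rep t).sz_eq

theorem mk_node_eq {n m : ℕ} {c : Fin n → PTree} {c' : Fin m → PTree} :
    mk (node n c) = mk (node m c') ↔ kids (node n c) = kids (node m c') := by
  classical
  rw [mk_eq]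
  constructor
  · rintro ⟨σ, h⟩
    simp only [kids]
    rw [← σ.sum_comp]
    exact sum_congr rfl fun i _ => by rw [mk_eq.2 (h i)]
  · intro h
    have key : ∀ b, Nonempty ({i // mk (c i) = b} ≃ {j // mk (c' j) = b}) := by
      intro b
      have := DFunLike.congr_fun h b
      simp only [kids, Finsupp.finsetSum_apply, Finsupp.single_apply] at this
      refine ⟨Fintype.equivOfCardEq ?_⟩
      rw [Fintype.card_subtype, Fintype.card_subtype]
      simpa [Finset.sum_boole] using this
    let e := fun b => (key b).some
    exact .node (Equiv.ofFiberEquiv e) fun i =>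
      mk_eq.1 (Equiv.ofFiberEquiv_map (f := fun i => mk (c i)) (g := fun j => mk (c' j)) e i).symm

/-- The children of the root of an isomorphism class. -/
def kidsT (t : RTree) : RTree →₀ ℕ := kids t.rep

theorem kidsT_mk (t : PTree) : kidsT (mk t) = kids t := by
  have h := mk_rep (mk t)
  unfold kidsT
  generalize (mk t).rep = s at h
  cases s; cases t
  exact mk_node_eq.1 h

theorem kidsT_bijective : Function.Bijective kidsT := by
  classical
  constructor
  · intro s t h
    rw [← mk_rep s, ← mk_rep t]
    unfold kidsT at h
    generalize s.rep = s at h ⊢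
    generalize t.rep = t at h ⊢
    cases s; cases t
    exact mk_node_eq.2 h
  · intro m
    suffices h : ∃ t, kids t = m by
      obtain ⟨t, rfl⟩ := h
      exact ⟨_, kidsT_mk t⟩
    induction m using Finsupp.induction_linear with
    | zero => exact ⟨.node 0 Fin.elim0, by simp [kids]⟩
    | add f g hf hg =>
      obtain ⟨⟨n, c⟩, rfl⟩ := hf
      obtain ⟨⟨m, c'⟩, rfl⟩ := hg
      exact ⟨.node (n + m) (Fin.append c c'), by simp [kids, Fin.sum_univ_add]⟩
    | single b k =>
      exact ⟨.node k fun _ => b.rep, by simp [kids]⟩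

/-- An isomorphism class of rooted trees is the same as a finite multiset of such classes. -/
def kidsEquiv : RTree ≃ (RTree →₀ ℕ) := Equiv.ofBijective _ kidsT_bijective

theorem finite_size_le (n : ℕ) : {t : RTree | size t ≤ n}.Finite := by
  induction n with
  | zero =>
    refine Set.Finite.subset Set.finite_empty fun t ht => ?_
    rw [Set.mem_ofPred_eq, ← mk_rep t, size_mk] at ht
    generalize t.rep = s at ht
    cases s
    rw [sz_node] at ht
    omega
  | succ n ih =>
    have : Finite {t : RTree | size t ≤ n} := ih
    refine Set.Finite.subset (Set.finite_iUnion fun k : Fin (n + 1) =>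
      Set.finite_range fun c : Fin k → {t : RTree | size t ≤ n} =>
        mk (node k fun i => (c i).1.rep)) fun t ht => ?_
    rw [Set.mem_ofPred_eq, ← mk_rep t, size_mk] at ht
    rw [← mk_rep t]
    generalize t.rep = s at ht ⊢
    obtain ⟨k, c⟩ := s
    rw [sz_node] at ht
    have h1 : ∀ i, 1 ≤ sz (c i) := fun i => by
      generalize c i = u
      cases u
      rw [sz_node]; omega
    have h2 : ∀ i, sz (c i) ≤ n := fun i => by
      have := single_le_sum (f := fun i => sz (c i)) (fun _ _ => Nat.zero_le _) (mem_univ i)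
      omega
    have h3 : k ≤ n := by
      have := sum_le_sum (s := univ) fun i _ => h1 i
      simp at this
      omega
    refine Set.mem_iUnion.2 ⟨⟨k, by omega⟩, ⟨fun i => ⟨mk (c i), by
      rw [Set.mem_ofPred_eq, size_mk]; exact h2 i⟩, ?_⟩⟩
    exact mk_eq.2 (.node (Equiv.refl _) fun i => iso_rep _)

end RTree

namespace PTree

theorem sz_graft : ∀ {s : PTree} (v : Vertex s) (t : PTree), sz (graft v t) = sz s + sz t := by
  intro s v t
  induction v with
  | @root n c =>
    rw [graft, sz_node, sz_node, Fin.sum_univ_succ]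
    simp; omega
  | @child n c i v ih =>
    rw [graft, sz_node, sz_node, ← add_sum_erase _ _ (mem_univ i),
      ← add_sum_erase _ (fun i => sz (c i)) (mem_univ i)]
    have : ∑ x ∈ univ.erase i, sz (Function.update c i (graft v t) x)
        = ∑ x ∈ univ.erase i, sz (c x) :=
      sum_congr rfl fun j hj => by rw [Function.update_of_ne (ne_of_mem_erase hj)]
    rw [this]
    simp [ih]; omega

theorem sz_eraseChild {n : ℕ} (c : Fin n → PTree) (i : Fin n) :
    sz (eraseChild c i) + sz (c i) = sz (node n c) := by
  cases n with
  | zero => exact i.elim0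
  | succ n =>
    rw [eraseChild, sz_node, sz_node, Fin.sum_univ_succAbove _ i]
    omega

theorem sz_cut {t : PTree} (e : Edge t) : sz (keep e) + sz (cutOff e) = sz t := by
  induction e with
  | @atRoot n c i => exact sz_eraseChild c i
  | @inChild n c i v ih =>
    rw [keep, cutOff, sz_node, sz_node, ← add_sum_erase _ _ (mem_univ i),
      ← add_sum_erase _ (fun i => sz (c i)) (mem_univ i)]
    have : ∑ x ∈ univ.erase i, sz (Function.update c i (keep v) x)
        = ∑ x ∈ univ.erase i, sz (c x) :=
      sum_congr rfl fun j hj => by rw [Function.update_of_ne (ne_of_mem_erase hj)]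
    rw [this]
    simp; omega

end PTree

theorem size_add_of_alpha {t₁ t₂ t₃ : RTree} (h : alpha t₁ t₂ t₃ ≠ 0) :
    size t₃ + size t₁ = size t₂ := by
  obtain ⟨e, h1, h2⟩ := Set.nonempty_of_ncard_ne_zero h
  rw [← h1, ← h2, size_mk, size_mk, sz_cut]
  rfl

theorem size_add_of_beta {t₁ t₂ t₃ : RTree} (h : beta t₁ t₂ t₃ ≠ 0) :
    size t₁ = size t₃ + size t₂ := by
  obtain ⟨v, h1⟩ := Set.nonempty_of_ncard_ne_zero h
  rw [h1, size_mk, sz_graft]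
  rfl

theorem one_le_size (t : RTree) : 1 ≤ size t := by
  rw [← mk_rep t, size_mk]
  generalize t.rep = s
  cases s
  rw [sz_node]; omega

theorem alpha_self (t r : RTree) : alpha t t r = 0 := by
  by_contra h
  have := size_add_of_alpha h
  have := one_le_size r
  omega

theorem beta_self (t r : RTree) : beta t t r = 0 := by
  by_contra h
  have := size_add_of_beta h
  have := one_le_size r
  omega

/-- The polynomial ring on isomorphism classes of trees (spanned by the forests). -/
abbrev Forest : Type := MvPolynomial RTree ℂ

/-- Joining the trees of a forest to a new root. -/
def join : Forest →ₗ[ℂ] Forest :=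
  (basisMonomials RTree ℂ).constr ℂ fun m => X (kidsEquiv.symm m)

theorem join_monomial (m : RTree →₀ ℕ) : join (monomial m 1) = X (kidsEquiv.symm m) := by
  have := (basisMonomials RTree ℂ).constr_basis ℂ (fun m => (X (kidsEquiv.symm m) : Forest)) m
  rwa [coe_basisMonomials] at this

/-- The forest of the children of the root. -/
def prodX {n : ℕ} (c : Fin n → PTree) : Forest := ∏ i, X (mk (c i))

theorem prodX_eq {n : ℕ} (c : Fin n → PTree) : prodX c = monomial (kids (node n c)) 1 := by
  simp only [prodX, kids, X]
  rw [← monomial_sum_one]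

theorem join_prodX {n : ℕ} (c : Fin n → PTree) : join (prodX c) = X (mk (node n c)) := by
  rw [prodX_eq, join_monomial]
  congr 1
  exact kidsEquiv.symm_apply_eq.2 (kidsT_mk _).symm

theorem join_injective : Function.Injective join := by
  have : LinearIndependent ℂ (fun m => (X (kidsEquiv.symm m) : Forest)) := by
    have h := (basisMonomials RTree ℂ).linearIndependent.comp
      (fun m => Finsupp.single (kidsEquiv.symm m) 1) (fun a b h => by
        simpa using Finsupp.single_left_injective one_ne_zero h)
    rw [coe_basisMonomials] at h
    exact h
  have h2 : ∀ p, join p = Finsupp.linearCombination ℂ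
      (fun m => (X (kidsEquiv.symm m) : Forest)) ((basisMonomials RTree ℂ).repr p) := fun p => by
    rw [join, Module.Basis.constr_apply, Finsupp.linearCombination_apply]
  intro p q hpq
  rw [h2, h2] at hpq
  exact (basisMonomials RTree ℂ).repr.injective (this hpq)

/-- The product of all children but the `i`-th. -/
def prodErase {n : ℕ} (c : Fin n → PTree) (i : Fin n) : Forest :=
  ∏ j ∈ univ.erase i, X (mk (c j))

theorem prodX_update {n : ℕ} (c : Fin n → PTree) (i : Fin n) (u : PTree) :
    prodX (Function.update c i u) = prodErase c i * X (mk u) := by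
  rw [prodX, ← mul_prod_erase _ _ (mem_univ i), mul_comm]
  congr 1
  · exact prod_congr rfl fun j hj => by rw [Function.update_of_ne (ne_of_mem_erase hj)]
  · simp

theorem join_prodErase {n : ℕ} (c : Fin n → PTree) (i : Fin n) :
    join (prodErase c i) = X (mk (eraseChild c i)) := by
  cases n with
  | zero => exact i.elim0
  | succ n =>
    rw [eraseChild, ← join_prodX, prodX, prodErase]
    congr 1
    have h1 := Fin.prod_univ_succAbove (fun j => (X (mk (c j)) : Forest)) i
    have h2 := mul_prod_erase univ (fun j => (X (mk (c j)) : Forest)) (mem_univ i)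
    exact mul_left_cancel₀ (X_ne_zero (R := ℂ) (mk (c i))) (h2.trans h1)

theorem derivation_prodX (D : Derivation ℂ Forest Forest) {n : ℕ} (c : Fin n → PTree) :
    D (prodX c) = ∑ i, prodErase c i * D (X (mk (c i))) := by
  have : ∀ s : Finset (Fin n), D (∏ i ∈ s, X (mk (c i)))
      = ∑ i ∈ s, (∏ j ∈ s.erase i, X (mk (c j))) * D (X (mk (c i))) := by
    intro s
    induction s using Finset.induction_on with
    | empty => simp
    | insert a s ha ih =>
      rw [prod_insert ha, D.leibniz, ih, sum_insert ha, erase_insert ha, add_comm, smul_eq_mul,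
        smul_eq_mul, mul_sum]
      congr 1
      refine sum_congr rfl fun i hi => ?_
      rw [erase_insert_of_ne (by rintro rfl; exact ha hi), prod_insert (by simp [ha]), mul_assoc]
  exact this univ

/-- Every vector is determined by the values on products `prodX c`. -/
theorem linearMap_ext {f g : Forest →ₗ[ℂ] Forest}
    (h : ∀ (n : ℕ) (c : Fin n → PTree), f (prodX c) = g (prodX c)) : f = g := by
  refine (basisMonomials RTree ℂ).ext fun m => ?_
  obtain ⟨t, rfl⟩ := kidsT_bijective.2 m
  rw [coe_basisMonomials]
  have h1 := h
  rw [← mk_rep t, kidsT_mk]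
  generalize t.rep = s
  obtain ⟨n, c⟩ := s
  change f (monomial (kids (node n c)) 1) = g (monomial (kids (node n c)) 1)
  rw [← prodX_eq]
  exact h n c

/-- The intertwining relation between a derivation and its action on forests. -/
def Twist (D : Derivation ℂ Forest Forest) (a : Forest →ₗ[ℂ] Forest) : Prop :=
  ∀ p, D (join p) = join (D p + a p)

theorem Twist.unique {D D' : Derivation ℂ Forest Forest} {a : Forest →ₗ[ℂ] Forest}
    (h : Twist D a) (h' : Twist D' a) : D = D' := by
  refine derivation_ext fun t => ?_
  rw [← mk_rep t]
  generalize t.rep = s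
  induction s with
  | node n c ih =>
    rw [← join_prodX, h, h', derivation_prodX, derivation_prodX]
    simp [ih]

theorem Twist.add {D D' : Derivation ℂ Forest Forest} {a a' : Forest →ₗ[ℂ] Forest}
    (h : Twist D a) (h' : Twist D' a') : Twist (D + D') (a + a') := fun p => by
  simp only [Derivation.add_apply, LinearMap.add_apply, h p, h' p, ← map_add]
  congr 1; abel

theorem Twist.smul {D : Derivation ℂ Forest Forest} {a : Forest →ₗ[ℂ] Forest}
    (k : ℂ) (h : Twist D a) : Twist (k • D) (k • a) := fun p => by
  simp only [Derivation.smul_apply, LinearMap.smul_apply, h p, ← map_smul, smul_add]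

theorem Twist.zero : Twist 0 0 := fun p => by simp

theorem Twist.lie {D D' : Derivation ℂ Forest Forest} {a a' : Forest →ₗ[ℂ] Forest}
    (h : Twist D a) (h' : Twist D' a') {b : Forest →ₗ[ℂ] Forest}
    (hb : ∀ p, b p = (D (a' p) - a' (D p)) + (a (D' p) - D' (a p)) + (a (a' p) - a' (a p))) :
    Twist ⁅D, D'⁆ b := fun p => by
  rw [Derivation.commutator_apply, h', h, h, h', Derivation.commutator_apply, hb, ← map_sub]
  congr 1
  simp only [map_add]
  abel

/-- Insertion of `t`, as a derivation. -/
def insD (t : RTree) : Derivation ℂ Forest Forest :=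
  mkDerivation ℂ fun u => ∑ v : u.rep.Vertex, X (mk (graft v t.rep))

open scoped Classical in
/-- Elimination of `t`, as a derivation. -/
def elimD (t : RTree) : Derivation ℂ Forest Forest :=
  mkDerivation ℂ fun u => ∑ e : u.rep.Edge, if mk (cutOff e) = t then X (mk (keep e)) else 0

/-- The degree derivation. -/
def degD : Derivation ℂ Forest Forest :=
  mkDerivation ℂ fun u => (size u : ℂ) • X u

theorem sum_graft_node {n : ℕ} (c : Fin n → PTree) (t : PTree) :
    (∑ v : Vertex (node n c), X (mk (graft v t)) : Forest) =
      join (X (mk t) * prodX c + ∑ i, prodErase c i * ∑ v : Vertex (c i), X (mk (graft v t))) := by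
  rw [sum_vertex, map_add, map_sum]
  congr 1
  · rw [graft, ← join_prodX, prodX, Fin.prod_univ_succ]
    rfl
  · refine sum_congr rfl fun i _ => ?_
    rw [mul_sum, map_sum]
    refine sum_congr rfl fun v _ => ?_
    rw [graft, ← join_prodX, prodX_update]

theorem prodX_congr {n m : ℕ} {c : Fin n → PTree} {c' : Fin m → PTree} (σ : Fin n ≃ Fin m)
    (h : ∀ i, Iso (c i) (c' (σ i))) : prodX c = prodX c' := by
  rw [prodX, prodX, ← σ.prod_comp]
  exact prod_congr rfl fun i _ => by rw [mk_eq.2 (h i)]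

theorem prodErase_congr {n m : ℕ} {c : Fin n → PTree} {c' : Fin m → PTree} (σ : Fin n ≃ Fin m)
    (h : ∀ i, Iso (c i) (c' (σ i))) (i : Fin n) : prodErase c i = prodErase c' (σ i) := by
  rw [prodErase, prodErase]
  refine prod_equiv σ (by simp) fun j _ => by rw [mk_eq.2 (h j)]

theorem sum_graft_congr {u u' t : PTree} (h : Iso u u') :
    (∑ v : Vertex u, X (mk (graft v t)) : Forest) = ∑ v : Vertex u', X (mk (graft v t)) := by
  induction h with
  | node σ h ih =>
    rw [sum_graft_node, sum_graft_node, prodX_congr σ h, ← σ.sum_comp]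
    congr 2
    exact sum_congr rfl fun i _ => by rw [ih i, prodErase_congr σ h i]

open scoped Classical in
theorem sum_cut_node {n : ℕ} (c : Fin n → PTree) (t : RTree) :
    (∑ e : Edge (node n c), if mk (cutOff e) = t then X (mk (keep e)) else 0 : Forest) =
      join (∑ i, (if mk (c i) = t then prodErase c i else 0) + ∑ i, prodErase c i *
        ∑ e : Edge (c i), if mk (cutOff e) = t then X (mk (keep e)) else 0) := by
  rw [sum_edge, map_add, map_sum, map_sum]
  congr 1
  · refine sum_congr rfl fun i _ => ?_
    rw [apply_ite join, join_prodErase, map_zero]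
    rfl
  · refine sum_congr rfl fun i _ => ?_
    rw [mul_sum, map_sum]
    refine sum_congr rfl fun v _ => ?_
    rw [mul_ite, mul_zero, apply_ite join, map_zero, ← prodX_update, join_prodX]
    rfl

open scoped Classical in
theorem sum_cut_congr {u u' : PTree} {t : RTree} (h : Iso u u') :
    (∑ e : Edge u, if mk (cutOff e) = t then X (mk (keep e)) else 0 : Forest) =
      ∑ e : Edge u', if mk (cutOff e) = t then X (mk (keep e)) else 0 := by
  induction h with
  | node σ h ih =>
    rw [sum_cut_node, sum_cut_node, ← σ.sum_comp, ← σ.sum_comp]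
    congr 2
    · exact sum_congr rfl fun i _ => by rw [prodErase_congr σ h i, mk_eq.2 (h i)]
    · exact sum_congr rfl fun i _ => by rw [ih i, prodErase_congr σ h i]

theorem insD_X (t : RTree) (u : PTree) :
    insD t (X (mk u)) = ∑ v : Vertex u, X (mk (graft v t.rep)) := by
  rw [insD, mkDerivation_X]
  exact sum_graft_congr (iso_rep u)

open scoped Classical in
theorem elimD_X (t : RTree) (u : PTree) :
    elimD t (X (mk u)) =
      ∑ e : Edge u, if mk (cutOff e) = t then X (mk (keep e)) else 0 := by
  rw [elimD, mkDerivation_X]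
  exact sum_cut_congr (iso_rep u)

theorem degD_X (u : RTree) : degD (X u) = (size u : ℂ) • (X u : Forest) := by
  rw [degD, mkDerivation_X]

theorem twist_of_prodX {D : Derivation ℂ Forest Forest} {a : Forest →ₗ[ℂ] Forest}
    (h : ∀ (n : ℕ) (c : Fin n → PTree), D (X (mk (node n c))) = join (D (prodX c) + a (prodX c))) :
    Twist D a := by
  have : (D : Forest →ₗ[ℂ] Forest) ∘ₗ join = join ∘ₗ ((D : Forest →ₗ[ℂ] Forest) + a) :=
    linearMap_ext fun n c => by simpa [join_prodX] using h n c
  exact fun p => LinearMap.congr_fun this p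

/-- Multiplication by the class `t`. -/
def mulX (t : RTree) : Forest →ₗ[ℂ] Forest := LinearMap.mulLeft ℂ (X t)

theorem twist_insD (t : RTree) : Twist (insD t) (mulX t) :=
  twist_of_prodX fun n c => by
    rw [insD_X, sum_graft_node, derivation_prodX, add_comm, mk_rep]
    simp [mulX, insD_X]

theorem twist_elimD (t : RTree) : Twist (elimD t) (pderiv t : Derivation ℂ Forest Forest) :=
  twist_of_prodX fun n c => by
    classical
    rw [elimD_X, sum_cut_node, derivation_prodX, Derivation.coeFn_coe, derivation_prodX, add_comm]
    simp [elimD_X, pderiv_X, Pi.single_apply, eq_comm]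

theorem twist_degD : Twist degD LinearMap.id :=
  twist_of_prodX fun n c => by
    rw [degD_X, derivation_prodX, ← join_prodX, ← map_smul, size_mk, sz_node]
    congr 1
    have : ∀ i, prodErase c i * degD (X (mk (c i))) = (sz (c i) : ℂ) • prodX c := fun i => by
      rw [degD_X, size_mk, mul_smul_comm, prodErase, prodX, mul_comm,
        mul_prod_erase univ (fun j => (X (mk (c j)) : Forest)) (mem_univ i)]
    simp only [this, ← sum_smul, LinearMap.id_apply]
    push_cast
    rw [add_smul, one_smul, add_comm]

theorem sum_fiber {ι M : Type*} [Fintype ι] [AddCommGroup M] [Module ℂ M] (f : ι → RTree)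
    (g : RTree → M) : ∑ e, g (f e) = ∑ᶠ r, ({e | f e = r}.ncard : ℂ) • g r := by
  classical
  rw [finsum_eq_sum_of_support_subset (s := univ.image f)]
  · rw [← sum_fiberwise_of_maps_to (g := f) (t := univ.image f)
      (fun i _ => mem_image_of_mem f (mem_univ i))]
    refine sum_congr rfl fun r _ => ?_
    rw [sum_congr rfl (g := fun _ => g r) fun i hi => by rw [(mem_filter.1 hi).2], sum_const,
      Set.ncard_eq_toFinset_card', Nat.cast_smul_eq_nsmul]
    congr 2
    ext; simp
  · intro r hr
    rw [Function.mem_support] at hr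
    have h0 : {e | f e = r}.ncard ≠ 0 := fun h => hr (by rw [h]; simp)
    obtain ⟨e, rfl⟩ := Set.nonempty_of_ncard_ne_zero h0
    simp

theorem sum_fiber_ite {ι M : Type*} [Fintype ι] [AddCommGroup M] [Module ℂ M] (f : ι → RTree)
    (q : ι → Prop) [DecidablePred q] (g : RTree → M) :
    (∑ e, if q e then g (f e) else 0) = ∑ᶠ r, ({e | f e = r ∧ q e}.ncard : ℂ) • g r := by
  have h := sum_fiber (fun e : {e // q e} => f e) g
  rw [← sum_filter, sum_subtype (p := q) (univ.filter q) (by simp) (fun e => g (f e))]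
  rw [h]
  refine finsum_congr fun r => ?_
  rw [← Set.ncard_image_of_injective _ Subtype.val_injective]
  congr 3
  ext e
  simp [and_comm]

theorem insD_X_eq (t u : RTree) : insD t (X u) = ∑ᶠ r, (beta r t u : ℂ) • (X r : Forest) := by
  rw [insD, mkDerivation_X, sum_fiber (fun v : u.rep.Vertex => mk (graft v t.rep))]
  simp only [beta, eq_comm]

theorem elimD_X_eq (s t : RTree) : elimD s (X t) = ∑ᶠ r, (alpha s t r : ℂ) • (X r : Forest) := by
  classical
  rw [elimD, mkDerivation_X, sum_fiber_ite (fun e : t.rep.Edge => mk (keep e))]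
  rfl

theorem finite_of_size {f : RTree → ℂ} (n : ℕ) (h : ∀ r, f r ≠ 0 → size r ≤ n) :
    f.support.Finite :=
  (finite_size_le n).subset fun r hr => h r hr

theorem beta_fin (s t : RTree) : (fun r => (beta r s t : ℂ)).support.Finite :=
  finite_of_size (size t + size s) fun _ h => (size_add_of_beta (by exact_mod_cast h)).le

theorem beta_fin' (s t : RTree) : (fun r => (beta s t r : ℂ)).support.Finite :=
  finite_of_size (size s) fun _ h => by
    have := size_add_of_beta (t₁ := s) (by exact_mod_cast h); omega

theorem alpha_fin (s t : RTree) : (fun r => (alpha s r t : ℂ)).support.Finite :=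
  finite_of_size (size t + size s) fun _ h => (size_add_of_alpha (by exact_mod_cast h)).ge

theorem alpha_fin' (s t : RTree) : (fun r => (alpha s t r : ℂ)).support.Finite :=
  finite_of_size (size t) fun r h => by
    have := size_add_of_alpha (t₁ := s) (t₂ := t) (t₃ := r) (by exact_mod_cast h); omega

theorem sub_fin {f g : RTree → ℂ} (hf : f.support.Finite) (hg : g.support.Finite) :
    (fun r => f r - g r).support.Finite :=
  (hf.union hg).subset (Function.support_sub f g)

theorem finsum_smul {M : Type*} [AddCommMonoid M] [Module ℂ M] {f : RTree → ℂ}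
    (hf : f.support.Finite) (g : RTree → M) : ∑ᶠ r, f r • g r = ∑ r ∈ hf.toFinset, f r • g r :=
  finsum_eq_sum_of_support_subset _ fun r hr => by
    simp only [Set.Finite.coe_toFinset, Function.mem_support] at hr ⊢
    intro h
    exact hr (by rw [h, zero_smul])

theorem map_finsum_smul {M N : Type*} [AddCommMonoid M] [Module ℂ M] [AddCommMonoid N] [Module ℂ N]
    (φ : M →ₗ[ℂ] N) {f : RTree → ℂ} (hf : f.support.Finite) (g : RTree → M) :
    φ (∑ᶠ r, f r • g r) = ∑ᶠ r, f r • φ (g r) := by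
  rw [finsum_smul hf, finsum_smul hf, map_sum]
  simp only [map_smul]

theorem finsum_sub_smul {M : Type*} [AddCommGroup M] [Module ℂ M] {f g : RTree → ℂ}
    (hf : f.support.Finite) (hg : g.support.Finite) (a : RTree → M) :
    ∑ᶠ r, (f r - g r) • a r = ∑ᶠ r, f r • a r - ∑ᶠ r, g r • a r := by
  simp only [sub_smul]
  exact finsum_sub_distrib
    (hf.subset fun r hr h => hr (by simp only [h, zero_smul]))
    (hg.subset fun r hr h => hr (by simp only [h, zero_smul]))

/-- The action on forests, on basis vectors. -/
def actB : Idx → Derivation ℂ Forest Forest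
  | .d => degD
  | .plus t => insD t
  | .minus t => elimD t

/-- The twists of the actions of basis vectors. -/
def twB : Idx → Forest →ₗ[ℂ] Forest
  | .d => LinearMap.id
  | .plus t => mulX t
  | .minus t => (pderiv t : Derivation ℂ Forest Forest)

/-- The action of the insertion-elimination algebra on forests. -/
def act : Alg →ₗ[ℂ] Derivation ℂ Forest Forest := basis.constr ℂ actB

/-- The twist of the action. -/
def tw : Alg →ₗ[ℂ] Forest →ₗ[ℂ] Forest := basis.constr ℂ twB

theorem twist_actB : ∀ i, Twist (actB i) (twB i)
  | .d => twist_degD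
  | .plus t => twist_insD t
  | .minus t => twist_elimD t

theorem act_basis (i : Idx) : act (basis i) = actB i := basis.constr_basis ℂ actB i
theorem tw_basis (i : Idx) : tw (basis i) = twB i := basis.constr_basis ℂ twB i

theorem twist_act (x : Alg) : Twist (act x) (tw x) := by
  have h : x ∈ Submodule.span ℂ (Set.range basis) := basis.mem_span x
  induction h using Submodule.span_induction with
  | zero => simpa using Twist.zero
  | add x y _ _ hx hy => simpa using hx.add hy
  | smul k x _ hx => simpa using hx.smul k
  | mem x hx =>
    obtain ⟨i, rfl⟩ := hx
    rw [act_basis, tw_basis]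
    exact twist_actB i


theorem pderiv_finsum (s : RTree) {f : RTree → ℂ} (hf : f.support.Finite) :
    pderiv s (∑ᶠ r, f r • (X r : Forest)) = C (f s) := by
  classical
  have h := map_finsum_smul ((pderiv s : Derivation ℂ Forest Forest) : Forest →ₗ[ℂ] Forest) hf
    (fun r => (X r : Forest))
  rw [Derivation.coeFn_coe] at h
  rw [h, finsum_eq_single _ s fun r hr => by simp [pderiv_X_of_ne (R := ℂ) hr]]
  simp [MvPolynomial.smul_eq_C_mul]

theorem derivation_sum (S : Finset RTree) (D : RTree → Derivation ℂ Forest Forest) (p : Forest) :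
    (∑ u ∈ S, D u) p = ∑ u ∈ S, D u p := by
  classical
  induction S using Finset.induction_on with
  | empty => simp
  | insert a s ha ih => rw [sum_insert ha, sum_insert ha, Derivation.add_apply, ih]

theorem pderiv_comm (s : RTree) (D : Derivation ℂ Forest Forest) {f : RTree → ℂ}
    (hf : f.support.Finite) (h : ∀ u, pderiv s (D (X u)) = C (f u)) (p : Forest) :
    pderiv s (D p) - D (pderiv s p) = ∑ᶠ u, f u • pderiv u p := by
  classical
  have key : ⁅(pderiv s : Derivation ℂ Forest Forest), D⁆ =
      ∑ u ∈ hf.toFinset, f u • (pderiv u : Derivation ℂ Forest Forest) := by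
    refine derivation_ext fun u => ?_
    have h0 : D (pderiv s (X u)) = 0 := by
      rw [pderiv_X, Pi.single_apply]; split_ifs <;> simp
    rw [Derivation.commutator_apply, h0, sub_zero, h, derivation_sum]
    simp only [Derivation.smul_apply, pderiv_X, Pi.single_apply, smul_ite, smul_zero]
    by_cases hu : f u = 0
    · rw [hu, map_zero, eq_comm]
      refine sum_eq_zero fun r _ => ?_
      split_ifs with hr
      · rw [← hr, hu, zero_smul]
      · rfl
    · rw [sum_eq_single u]
      · simp [MvPolynomial.smul_eq_C_mul]
      · intro r _ hr
        rw [if_neg (Ne.symm hr)]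
      · simp [hu]
  have := DFunLike.congr_fun key p
  rw [Derivation.commutator_apply, derivation_sum] at this
  rw [this, finsum_smul hf]
  simp only [Derivation.smul_apply]

theorem pderiv_insD (s t : RTree) (p : Forest) :
    pderiv s (insD t p) - insD t (pderiv s p) = ∑ᶠ u, (beta s t u : ℂ) • pderiv u p :=
  pderiv_comm s _ (beta_fin' s t) (fun u => by rw [insD_X_eq, pderiv_finsum s (beta_fin t u)]) p

theorem pderiv_elimD (s t : RTree) (p : Forest) :
    pderiv s (elimD t p) - elimD t (pderiv s p) = ∑ᶠ u, (alpha t u s : ℂ) • pderiv u p :=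
  pderiv_comm s _ (alpha_fin t s) (fun u => by rw [elimD_X_eq, pderiv_finsum s (alpha_fin' t u)]) p

theorem pderiv_degD (s : RTree) (p : Forest) :
    pderiv s (degD p) - degD (pderiv s p) = (size s : ℂ) • pderiv s p := by
  classical
  have := pderiv_comm s degD (f := fun u => if u = s then (size s : ℂ) else 0)
    ((Set.finite_singleton s).subset fun u => by simp; tauto)
    (fun u => by
      rw [degD_X, Derivation.map_smul, pderiv_X, Pi.single_apply, MvPolynomial.smul_eq_C_mul]
      by_cases h1 : u = s
      · simp [h1]
      · simp [h1]) p
  rw [this, finsum_eq_single _ s fun r hr => by simp [hr]]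
  simp

theorem tw_plus {f : RTree → ℂ} (hf : f.support.Finite) (p : Forest) :
    tw (∑ᶠ r, f r • Dp r) p = (∑ᶠ r, f r • (X r : Forest)) * p := by
  have h := map_finsum_smul (LinearMap.applyₗ p ∘ₗ tw) hf Dp
  have h2 := map_finsum_smul (LinearMap.mulRight ℂ p) hf fun r => (X r : Forest)
  rw [LinearMap.mulRight_apply] at h2
  rw [h2]
  refine h.trans (finsum_congr fun r => ?_)
  rw [LinearMap.comp_apply, Dp, tw_basis]
  rfl

theorem tw_minus {f : RTree → ℂ} (hf : f.support.Finite) (p : Forest) :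
    tw (∑ᶠ r, f r • Dm r) p = ∑ᶠ r, f r • pderiv r p := by
  have h := map_finsum_smul (LinearMap.applyₗ p ∘ₗ tw) hf Dm
  refine h.trans (finsum_congr fun r => ?_)
  rw [LinearMap.comp_apply, Dm, tw_basis]
  rfl

theorem tw_d : tw d = LinearMap.id := tw_basis _
theorem tw_Dp (t : RTree) : tw (Dp t) = mulX t := tw_basis _
theorem tw_Dm (t : RTree) : tw (Dm t) = (pderiv t : Derivation ℂ Forest Forest) := tw_basis _

theorem mulX_apply (t : RTree) (p : Forest) : mulX t p = X t * p := rfl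

theorem act_brMinusPlus (s t : RTree) : act (brMinusPlus s t) = ⁅elimD s, insD t⁆ := by
  classical
  refine (twist_act _).unique ((twist_elimD s).lie (twist_insD t) fun p => ?_)
  rw [Derivation.coeFn_coe, pderiv_insD, mulX_apply, mulX_apply, mulX_apply, Derivation.leibniz,
    elimD_X_eq, Derivation.leibniz, pderiv_X, Pi.single_apply]
  unfold brMinusPlus
  by_cases h : s = t
  · subst h
    simp [alpha_self, beta_self, tw_d]
  · rw [if_neg h, if_neg (Ne.symm h), map_add, LinearMap.add_apply, tw_plus (alpha_fin' s t),
      tw_minus (beta_fin' s t)]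
    simp only [smul_eq_mul]
    ring

theorem act_br_d_minus (t : RTree) : act (-(size t : ℂ) • Dm t) = ⁅degD, elimD t⁆ := by
  refine (twist_act _).unique (twist_degD.lie (twist_elimD t) fun p => ?_)
  have := pderiv_degD t p
  simp only [map_smul, tw_Dm, LinearMap.smul_apply, Derivation.coeFn_coe, LinearMap.id_apply,
    neg_smul, map_neg, LinearMap.neg_apply, ← this]
  ring

theorem act_br_d_plus (t : RTree) : act ((size t : ℂ) • Dp t) = ⁅degD, insD t⁆ := by
  refine (twist_act _).unique (twist_degD.lie (twist_insD t) fun p => ?_)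
  simp only [map_smul, tw_Dp, LinearMap.smul_apply, mulX_apply, LinearMap.id_apply,
    Derivation.leibniz, degD_X, smul_eq_mul, MvPolynomial.smul_eq_C_mul]
  ring

theorem act_br : ∀ i j, act (br i j) = ⁅actB i, actB j⁆
  | .plus s, .plus t => by
    refine (twist_act _).unique ((twist_insD s).lie (twist_insD t) fun p => ?_)
    simp only [mulX_apply, Derivation.leibniz, insD_X_eq, smul_eq_mul]
    rw [br, tw_plus (sub_fin (beta_fin s t) (beta_fin t s)),
      finsum_sub_smul (beta_fin s t) (beta_fin t s)]
    ring
  | .minus s, .minus t => by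
    refine (twist_act _).unique ((twist_elimD s).lie (twist_elimD t) fun p => ?_)
    have h1 := pderiv_elimD s t p
    have h2 := pderiv_elimD t s p
    have h3 : pderiv s (pderiv t p) - pderiv t (pderiv s p) = 0 := by
      have := pderiv_comm s (pderiv t) (f := 0) (by simp) (fun u => by
        classical
        rw [pderiv_X, Pi.single_apply]; split_ifs <;> simp) p
      simpa using this
    rw [Derivation.coeFn_coe, Derivation.coeFn_coe, h1, h3, br,
      tw_minus (sub_fin (alpha_fin t s) (alpha_fin s t)),
      finsum_sub_smul (alpha_fin t s) (alpha_fin s t), ← h2]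
    ring
  | .minus s, .plus t => act_brMinusPlus s t
  | .plus t, .minus s => by
    rw [br, map_neg, act_brMinusPlus]; exact lie_skew _ _
  | .d, .d => by rw [br, map_zero, lie_self]
  | .d, .minus t => act_br_d_minus t
  | .minus t, .d => by
    rw [br, ← neg_neg (size t : ℂ), neg_smul, map_neg, act_br_d_minus]; exact lie_skew _ _
  | .d, .plus t => act_br_d_plus t
  | .plus t, .d => by
    rw [br, neg_smul, map_neg, act_br_d_plus]; exact lie_skew _ _

theorem act_brLin (x y : Alg) : act (brLin x y) = ⁅act x, act y⁆ := by
  have h : brLin.compr₂ act = ((LieModule.toEnd ℂ (Derivation ℂ Forest Forest)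
      (Derivation ℂ Forest Forest) : _ →ₗ[ℂ] _) ∘ₗ act).compl₂ act := by
    refine basis.ext fun i => basis.ext fun j => ?_
    simp only [LinearMap.compr₂_apply, LinearMap.compl₂_apply, LinearMap.comp_apply, act_basis]
    rw [brLin, basis.constr_basis, basis.constr_basis, act_br]
    rfl
  exact LinearMap.congr_fun₂ h x y

theorem coeff_tw_d (x : Alg) : coeff 0 (tw x 1) = basis.coord Idx.d x := by
  have : lcoeff ℂ 0 ∘ₗ LinearMap.applyₗ 1 ∘ₗ tw = basis.coord Idx.d := basis.ext fun i => by
    rw [basis.coord_apply, basis.repr_self, LinearMap.comp_apply, LinearMap.comp_apply, tw_basis]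
    rcases i with _ | t | t
    · simp [twB]
    · simp [twB, mulX_apply]
    · simp [twB]
  exact LinearMap.congr_fun this x

theorem coeff_tw_plus (t : RTree) (x : Alg) :
    coeff (Finsupp.single t 1) (tw x 1) = basis.coord (Idx.plus t) x := by
  classical
  have : lcoeff ℂ (Finsupp.single t 1) ∘ₗ LinearMap.applyₗ 1 ∘ₗ tw = basis.coord (Idx.plus t) :=
    basis.ext fun i => by
      rw [basis.coord_apply, basis.repr_self, LinearMap.comp_apply, LinearMap.comp_apply, tw_basis]
      rcases i with _ | s | s
      · simp [twB, coeff_one, eq_comm (a := (0 : RTree →₀ ℕ))]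
      · simp [twB, mulX_apply, coeff_X, Finsupp.single_apply, Finsupp.single_left_inj]
      · simp [twB]
  exact LinearMap.congr_fun this x

theorem coeff_tw_minus (t : RTree) (x : Alg) :
    coeff 0 (tw x (X t)) = basis.coord (Idx.minus t) x := by
  classical
  have : lcoeff ℂ 0 ∘ₗ LinearMap.applyₗ (X t) ∘ₗ tw = basis.coord (Idx.minus t) :=
    basis.ext fun i => by
      rw [basis.coord_apply, basis.repr_self, LinearMap.comp_apply, LinearMap.comp_apply, tw_basis]
      rcases i with _ | s | s
      · simp [twB]
      · simp [twB, mulX_apply, ← constantCoeff_eq]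
      · simp [twB, pderiv_X, Pi.single_apply, Finsupp.single_apply, apply_ite (coeff 0), eq_comm]
  exact LinearMap.congr_fun this x

theorem act_injective : Function.Injective act := by
  rw [← LinearMap.ker_eq_bot, LinearMap.ker_eq_bot']
  intro x hx
  have h : ∀ p, tw x p = 0 := fun p => join_injective (by
    have := twist_act x p
    rw [hx] at this
    simpa using this.symm)
  refine basis.ext_elem fun i => ?_
  change basis.coord i x = basis.coord i 0
  rw [map_zero]
  rcases i with _ | t | t
  · rw [← coeff_tw_d, h, coeff_zero]
  · rw [← coeff_tw_plus, h, coeff_zero]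
  · rw [← coeff_tw_minus, h, coeff_zero]

theorem brLin_self (x : Alg) : brLin x x = 0 :=
  act_injective (by rw [map_zero, act_brLin, lie_self])

theorem brLin_jacobi (x y z : Alg) :
    brLin x (brLin y z) = brLin (brLin x y) z + brLin y (brLin x z) :=
  act_injective (by
    simp only [map_add, act_brLin]
    exact LieRing.leibniz_lie _ _ _)

end Jacobi

/-- The Lie bracket of the insertion-elimination algebra `𝔤`. -/
instance : LieRing Alg where
  bracket x y := brLin x y
  add_lie x y z := LinearMap.map_add₂ brLin x y z
  lie_add x y z := map_add (brLin x) y z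
  lie_self x := brLin_self x
  leibniz_lie x y z := brLin_jacobi x y z

instance : LieAlgebra ℂ Alg where
  lie_smul c x y := map_smul (brLin x) c y

theorem lie_basis (i j : Idx) : ⁅basis i, basis j⁆ = br i j := by
  change brLin (basis i) (basis j) = br i j
  rw [brLin, basis.constr_basis, basis.constr_basis]

section Relations

open RTree

/-! The defining relations. -/

theorem lie_Dp_Dp (s t : RTree) :
    ⁅Dp s, Dp t⁆ = ∑ᶠ r, ((beta r s t : ℂ) - (beta r t s : ℂ)) • Dp r := lie_basis _ _

theorem lie_Dm_Dm (s t : RTree) :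
    ⁅Dm s, Dm t⁆ = ∑ᶠ r, ((alpha t r s : ℂ) - (alpha s r t : ℂ)) • Dm r := lie_basis _ _

theorem lie_Dm_Dp {s t : RTree} (h : s ≠ t) :
    ⁅Dm s, Dp t⁆ = ∑ᶠ r, (alpha s t r : ℂ) • Dp r + ∑ᶠ r, (beta s t r : ℂ) • Dm r :=
  (lie_basis _ _).trans (if_neg h)

theorem lie_Dm_Dp_self (t : RTree) : ⁅Dm t, Dp t⁆ = d := (lie_basis _ _).trans (if_pos rfl)

theorem lie_d_Dm (t : RTree) : ⁅d, Dm t⁆ = -(size t : ℂ) • Dm t := lie_basis _ _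

theorem lie_d_Dp (t : RTree) : ⁅d, Dp t⁆ = (size t : ℂ) • Dp t := lie_basis _ _

end Relations

/-- The homogeneous component `𝔤_n = {x ∈ 𝔤 | [d, x] = n x}`. -/
def wt (n : ℤ) : Submodule ℂ Alg where
  carrier := {x | ⁅d, x⁆ = (n : ℂ) • x}
  zero_mem' := by simp
  add_mem' {x y} hx hy := by
    change ⁅d, x + y⁆ = _
    rw [lie_add, smul_add]
    exact congrArg₂ _ hx hy
  smul_mem' c x hx := by
    change ⁅d, c • x⁆ = _
    rw [lie_smul, smul_comm (n : ℂ) c x]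
    exact congrArg _ hx

/-- The tree with two vertices. -/
def edgeTree : RTree := RTree.mk (.node 1 fun _ => .node 0 Fin.elim0)

/-- The tree whose root has two children, both leaves. -/
def cherryTree : RTree := RTree.mk (.node 2 fun _ => .node 0 Fin.elim0)

end InsElim

end

/-! The theorem rests on one fact, `CommProp`: two commuting elements, homogeneous of degrees of the
same strict sign and the first nonzero, are proportional. Let `s` be finite-dimensional, with top
degree N > 0, reached by some x in `s`. If z in `s` has top degree k > 0, then [x, z] cannot have
degree N + k, so the leading components of x and z commute. They are proportional, whence k = N. So
modulo degrees ≤ 0 the subalgebra `s` is at most a line (`exists_sub_smul_mem_fil`), and the same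
holds from below.

The degree 0 component of the algebra is the line of `d`. The elements of `s` of strictly negative
degree form a subalgebra, which is at most a line by the same argument from below. Hence dim `s` ≤ 1
+ 1 + 1. If dim `s` = 3, the parts of `s` in degrees ≤ 0 and ≥ 0 have dimension at least 2 each, so
they meet, and `d` lies in `s`. The two lines of strictly signed degree are then stable under ad
`d`, hence homogeneous.

`CommProp` comes from the action on the polynomial ring on trees, whose monomials are forests. `act
x` is a derivation, and `join` intertwines it with `forestAct x = act x + tw x`. Weight counts
vertices, and no nonzero polynomial has negative weight. In negative degree (`eq_zero_of_commute`)
`tw x` is a derivation that is constant on linear forms, and so `forestAct x` and `forestAct y` are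
commuting derivations. An equation `forestAct x q = u`, `forestAct y q = 0` can be solved by
integration by parts, and its solution shows that the coefficients of y vanish. In positive degree
(`commProp_one`) `tw x` and `tw y` are multiplications by linear forms A = `join` P and B = `join`
Q. Commutation gives an identity whose part with the largest number of trees is A Q' = B P', where
P', Q' are the components of P, Q in that degree. If A does not divide B, these forms are
non-associated primes, so B divides Q' and A divides P', which the weights forbid unless P' = Q' =
0. -/

noncomputable section

namespace InsElim

open PTree RTree MvPolynomial

/-! ### Grading and degree filtrations -/

/-- The degree of a basis vector. -/
def Idx.deg : Idx → ℤ
  | .d => 0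
  | .plus t => size t
  | .minus t => -(size t : ℤ)

theorem lie_d_basis (i : Idx) : ⁅d, basis i⁆ = (i.deg : ℂ) • basis i := by
  rw [d, lie_basis]
  cases i <;> simp [br, Idx.deg, Dp, Dm]

theorem repr_lie_d (x : Alg) (i : Idx) :
    basis.repr ⁅d, x⁆ i = (i.deg : ℂ) * basis.repr x i := by
  have : basis.coord i ∘ₗ brLin d = (i.deg : ℂ) • basis.coord i := basis.ext fun j => by
    have h := lie_d_basis j
    change brLin d (basis j) = _ at h
    rw [LinearMap.comp_apply, h]
    simp only [map_smul, Module.Basis.coord_apply, Module.Basis.repr_self, LinearMap.smul_apply,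
      smul_eq_mul]
    by_cases hij : j = i
    · rw [hij]
    · simp [hij]
  exact LinearMap.congr_fun this x

theorem mem_wt_iff {n : ℤ} {x : Alg} : x ∈ wt n ↔ ∀ i, basis.repr x i ≠ 0 → i.deg = n := by
  change ⁅d, x⁆ = (n : ℂ) • x ↔ _
  rw [← basis.repr.injective.eq_iff, DFunLike.ext_iff]
  refine forall_congr' fun i => ?_
  rw [repr_lie_d, map_smul, Finsupp.smul_apply, smul_eq_mul, mul_eq_mul_right_iff, Int.cast_inj]
  tauto

theorem basis_mem_wt (i : Idx) : basis i ∈ wt i.deg := lie_d_basis i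

theorem lie_mem_wt {m n : ℤ} {x y : Alg} (hx : x ∈ wt m) (hy : y ∈ wt n) :
    ⁅x, y⁆ ∈ wt (m + n) := by
  change ⁅d, ⁅x, y⁆⁆ = _
  rw [leibniz_lie, show ⁅d, x⁆ = (m : ℂ) • x from hx, show ⁅d, y⁆ = (n : ℂ) • y from hy,
    smul_lie, lie_smul, ← add_smul]
  push_cast; rfl

theorem disjoint_wt {m n : ℤ} (h : m ≠ n) {x : Alg} (hx : x ∈ wt m) (hy : x ∈ wt n) : x = 0 := by
  refine basis.ext_elem fun i => ?_
  by_contra h0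
  rw [map_zero, Finsupp.zero_apply] at h0
  exact h ((mem_wt_iff.1 hx i h0).symm.trans (mem_wt_iff.1 hy i h0))

/-- Every tree has at least one vertex, so `d` is the only basis vector of degree 0. -/
theorem mem_wt_zero {x : Alg} (h : x ∈ wt 0) : ∃ c : ℂ, x = c • d := by
  classical
  refine ⟨basis.repr x .d, basis.ext_elem fun i => ?_⟩
  rw [d, map_smul, Module.Basis.repr_self, Finsupp.smul_single, smul_eq_mul, mul_one,
    Finsupp.single_apply]
  split_ifs with hi
  · rw [hi]
  · by_contra h0
    have h1 := mem_wt_iff.1 h i h0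
    rcases i with _ | t | t
    · exact hi rfl
    · have := one_le_size t
      simp only [Idx.deg] at h1; omega
    · have := one_le_size t
      simp only [Idx.deg] at h1; omega

/-- The increasing (`ε = 1`) or decreasing (`ε = -1`) filtration of the algebra by degree. -/
def fil (ε a : ℤ) : Submodule ℂ Alg := Submodule.span ℂ (basis '' {i | ε * i.deg ≤ a})

theorem mem_fil {ε a : ℤ} {x : Alg} :
    x ∈ fil ε a ↔ ∀ i, basis.repr x i ≠ 0 → ε * i.deg ≤ a := by
  rw [fil, basis.mem_span_image]
  simp [Set.subset_def]

theorem fil_mono {ε a b : ℤ} (h : a ≤ b) : fil ε a ≤ fil ε b := fun _ hx =>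
  mem_fil.2 fun i hi => (mem_fil.1 hx i hi).trans h

theorem wt_le_fil {ε n a : ℤ} (h : ε * n ≤ a) : wt n ≤ fil ε a := fun _ hx =>
  mem_fil.2 fun i hi => by rwa [mem_wt_iff.1 hx i hi]

theorem lie_mem_fil {ε a b : ℤ} {x y : Alg} (hx : x ∈ fil ε a) (hy : y ∈ fil ε b) :
    ⁅x, y⁆ ∈ fil ε (a + b) := by
  induction hx using Submodule.span_induction with
  | zero => simp
  | add x x' _ _ h h' => rw [add_lie]; exact add_mem h h'
  | smul c x _ h => rw [smul_lie]; exact Submodule.smul_mem _ _ h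
  | mem x hx =>
    obtain ⟨i, hi, rfl⟩ := hx
    induction hy using Submodule.span_induction with
    | zero => simp
    | add x x' _ _ h h' => rw [lie_add]; exact add_mem h h'
    | smul c x _ h => rw [lie_smul]; exact Submodule.smul_mem _ _ h
    | mem y hy =>
      obtain ⟨j, hj, rfl⟩ := hy
      refine wt_le_fil ?_ (lie_mem_wt (basis_mem_wt i) (basis_mem_wt j))
      rw [mul_add]
      exact add_le_add hi hj

open scoped Classical in
/-- The projection onto the component of degree `n`. -/
def proj (n : ℤ) : Alg →ₗ[ℂ] Alg := basis.constr ℂ fun i => if i.deg = n then basis i else 0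

open scoped Classical in
theorem repr_proj (n : ℤ) (x : Alg) (i : Idx) :
    basis.repr (proj n x) i = if i.deg = n then basis.repr x i else 0 := by
  have : basis.coord i ∘ₗ proj n = (if i.deg = n then 1 else 0 : ℂ) • basis.coord i :=
    basis.ext fun j => by
      rw [LinearMap.comp_apply, proj, basis.constr_basis]
      by_cases hij : j = i
      · subst hij
        split_ifs <;> simp
      · split_ifs <;> simp [hij]
  refine (LinearMap.congr_fun this x).trans ?_
  split_ifs <;> simp

theorem proj_mem_wt (n : ℤ) (x : Alg) : proj n x ∈ wt n := mem_wt_iff.2 fun i hi => by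
  classical
  rw [repr_proj] at hi
  by_contra h
  exact hi (if_neg h)

/-- Since ε² = 1, the top layer ε · deg = a is the component of degree ε · a; removing it lowers the
filtration index by one. -/
theorem sub_proj_mem_fil {ε a : ℤ} (hε : ε * ε = 1) {x : Alg} (hx : x ∈ fil ε a) :
    x - proj (ε * a) x ∈ fil ε (a - 1) := mem_fil.2 fun i hi => by
  classical
  rw [map_sub, Finsupp.sub_apply, repr_proj] at hi
  have h1 : i.deg ≠ ε * a := fun h => hi (by rw [if_pos h, sub_self])
  rw [if_neg h1, sub_zero] at hi
  have h2 := mem_fil.1 hx i hi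
  have h3 : ε * i.deg ≠ a := fun h => h1 (by rw [← h, ← mul_assoc, hε, one_mul])
  omega

theorem eq_zero_of_mem_fil_of_mem_wt {ε a n : ℤ} (h : a < ε * n) {x : Alg} (hx : x ∈ fil ε a)
    (hx' : x ∈ wt n) : x = 0 := by
  refine basis.ext_elem fun i => ?_
  by_contra h0
  rw [map_zero, Finsupp.zero_apply] at h0
  have h1 := mem_fil.1 hx i h0
  rw [mem_wt_iff.1 hx' i h0] at h1
  omega

/-- The leading components commute when the degree of the commutator drops. -/
theorem lie_proj_eq_zero {ε a b : ℤ} (hε : ε * ε = 1) {x y : Alg} (hx : x ∈ fil ε a)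
    (hy : y ∈ fil ε b) (h : ⁅x, y⁆ ∈ fil ε (a + b - 1)) :
    ⁅proj (ε * a) x, proj (ε * b) y⁆ = 0 := by
  have hpx : proj (ε * a) x ∈ fil ε a :=
    wt_le_fil (by rw [← mul_assoc, hε, one_mul]) (proj_mem_wt _ _)
  -- Replacing x and then y by its leading component changes the bracket only by terms of index at
  -- most a + b - 1. The bracket of the leading components has exact index a + b, so it must vanish.
  have h1 := lie_mem_fil (sub_proj_mem_fil hε hx) hy
  have h2 := lie_mem_fil hpx (sub_proj_mem_fil hε hy)
  rw [show a - 1 + b = a + b - 1 by ring] at h1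
  rw [← add_sub_assoc] at h2
  have h3 : ⁅proj (ε * a) x, proj (ε * b) y⁆ ∈ fil ε (a + b - 1) := by
    have := sub_mem (sub_mem h h1) h2
    rwa [sub_lie, lie_sub, sub_sub_cancel, sub_sub_cancel] at this
  refine eq_zero_of_mem_fil_of_mem_wt ?_ h3 (lie_mem_wt (proj_mem_wt _ _) (proj_mem_wt _ _))
  rw [← mul_add, ← mul_assoc, hε, one_mul]
  omega

theorem exists_mem_fil (ε : ℤ) (x : Alg) : ∃ N : ℕ, x ∈ fil ε N := by
  classical
  refine ⟨(basis.repr x).support.sup fun i => (ε * i.deg).toNat, mem_fil.2 fun i hi => ?_⟩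
  have := Finset.le_sup (f := fun i : Idx => (ε * i.deg).toNat) (Finsupp.mem_support_iff.2 hi)
  omega

theorem exists_le_fil (ε : ℤ) (s : Submodule ℂ Alg) [FiniteDimensional ℂ s] :
    ∃ N : ℕ, s ≤ fil ε N := by
  obtain ⟨S, hS⟩ := Submodule.fg_iff_finiteDimensional s |>.2 inferInstance
  choose N hN using exists_mem_fil ε
  refine ⟨S.sup N, ?_⟩
  rw [← hS, Submodule.span_le]
  intro x hx
  exact fil_mono (by exact_mod_cast Finset.le_sup (f := N) hx) (hN x)

/-! ### Leading components in a finite-dimensional subalgebra -/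

/-- Commuting nonzero elements of the algebra that are homogeneous of degrees with the sign of `ε`
are proportional. -/
def CommProp (ε : ℤ) : Prop :=
  ∀ m n : ℤ, 0 < m → 0 < n → ∀ x ∈ wt (ε * m), ∀ y ∈ wt (ε * n), ⁅x, y⁆ = 0 → x ≠ 0 →
    ∃ c : ℂ, y = c • x

/-- A finite-dimensional `s` has a largest index N + 1. All leading components of positive index in
`s` commute with that of an element reaching it, so they are multiples of it, and no positive index
other than N + 1 occurs. Thus `s` is at most a line modulo `fil ε 0`. -/
theorem exists_sub_smul_mem_fil {ε : ℤ} (hε : ε * ε = 1) (H : CommProp ε)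
    (s : LieSubalgebra ℂ Alg) [FiniteDimensional ℂ s] :
    ∃ x ∈ s, ∀ z ∈ s, ∃ c : ℂ, z - c • x ∈ fil ε 0 := by
  classical
  have hex := exists_le_fil ε s.toSubmodule
  obtain ⟨N, hN, hmin⟩ : ∃ N : ℕ, s.toSubmodule ≤ fil ε N ∧
      ∀ M < N, ¬ s.toSubmodule ≤ fil ε (M : ℕ) :=
    ⟨Nat.find hex, Nat.find_spec hex, fun M hM => Nat.find_min hex hM⟩
  rcases N with _ | N
  · exact ⟨0, s.zero_mem, fun z hz => ⟨0, by simpa using hN hz⟩⟩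
  obtain ⟨x, hxs, hx⟩ := SetLike.not_le_iff_exists.1 (hmin N (Nat.lt_succ_self N))
  have hp : proj (ε * (N + 1 : ℕ)) x ≠ 0 := fun h => hx (by
    have := sub_proj_mem_fil hε (hN hxs)
    rw [h, sub_zero] at this
    exact fil_mono (by push_cast; omega) this)
  -- The bracket of x and z stays in `s`, hence in index at most N + 1 ≤ (N + 1) + k - 1 because k ≥
  -- 1. So the leading components commute.
  have key : ∀ k : ℕ, 0 < k → ∀ z ∈ s, z ∈ fil ε k →
      ∃ c : ℂ, proj (ε * k) z = c • proj (ε * (N + 1 : ℕ)) x := fun k hk z hz hzk =>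
    H _ _ (by positivity) (by exact_mod_cast hk) _ (proj_mem_wt _ _) _ (proj_mem_wt _ _)
      (lie_proj_eq_zero hε (hN hxs) hzk (fil_mono (by push_cast; omega) (hN (s.lie_mem hxs hz)))) hp
  have low : ∀ k : ℕ, k < N + 1 → ∀ z ∈ s, z ∈ fil ε k → z ∈ fil ε 0 := by
    intro k
    induction k with
    | zero => intro _ z _ h; exact_mod_cast h
    | succ k ih =>
      intro hk z hz hzk
      obtain ⟨c, hc⟩ := key (k + 1) k.succ_pos z hz hzk
      -- This component is a multiple of one of another degree, so it is zero and the index of z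
      -- drops.
      have h0 : proj (ε * (k + 1 : ℕ)) z = 0 := by
        refine disjoint_wt (m := ε * (k + 1 : ℕ)) (n := ε * (N + 1 : ℕ)) ?_ (proj_mem_wt _ _)
          (hc ▸ Submodule.smul_mem _ _ (proj_mem_wt _ _))
        intro h
        have := mul_left_cancel₀ (fun h => by simp [h] at hε) h
        omega
      have := sub_proj_mem_fil hε hzk
      rw [h0, sub_zero] at this
      exact ih (by omega) z hz (fil_mono (by push_cast; omega) this)
  refine ⟨x, hxs, fun z hz => ?_⟩
  obtain ⟨c, hc⟩ := key (N + 1) N.succ_pos z hz (hN hz)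
  have hzs : z - c • x ∈ s := s.sub_mem hz (s.smul_mem c hxs)
  refine ⟨c, low N N.lt_succ_self _ hzs ?_⟩
  have := sub_proj_mem_fil hε (hN hzs)
  rw [map_sub, map_smul, hc, sub_self, sub_zero] at this
  exact fil_mono (by push_cast; omega) this

/-! ### The action on forests -/

/-- The action of the algebra on forests obtained from `act` by joining forests to trees. -/
def forestAct (x : Alg) : Forest →ₗ[ℂ] Forest := (act x : Forest →ₗ[ℂ] Forest) + tw x

theorem forestAct_apply (x : Alg) (p : Forest) : forestAct x p = act x p + tw x p := rfl

theorem act_join (x : Alg) (p : Forest) : act x (join p) = join (forestAct x p) := twist_act x p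

theorem act_lie (x y : Alg) : act ⁅x, y⁆ = ⁅act x, act y⁆ := act_brLin x y

/-- `act` respects brackets, and the injective map `join` carries `forestAct` to `act`. -/
theorem forestAct_lie (x y : Alg) (p : Forest) :
    forestAct ⁅x, y⁆ p = forestAct x (forestAct y p) - forestAct y (forestAct x p) :=
  join_injective (by
    rw [map_sub, ← act_join, ← act_join, ← act_join, ← act_join, ← act_join, act_lie,
      Derivation.commutator_apply])

/-- Expand `forestAct_lie` with `forestAct = act + tw` and cancel the part coming from `act`. For
commuting x and y the right side vanishes, which is the equation behind both halves of `CommProp`.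
-/
theorem tw_lie (x y : Alg) (p : Forest) :
    tw ⁅x, y⁆ p = (act x (tw y p) - tw y (act x p)) + (tw x (act y p) - act y (tw x p)) +
      (tw x (tw y p) - tw y (tw x p)) := by
  have h := forestAct_lie x y p
  simp only [forestAct_apply, act_lie, Derivation.commutator_apply, map_add] at h
  linear_combination h

theorem act_d : act d = degD := act_basis _

/-! ### Weights of polynomials in trees -/

/-- `p` is homogeneous of weight `w`, where each tree counts with its number of vertices. -/
def IsWt (w : ℤ) (p : Forest) : Prop := degD p = (w : ℂ) • p

theorem IsWt.mul {v w : ℤ} {p q : Forest} (hp : IsWt v p) (hq : IsWt w q) :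
    IsWt (v + w) (p * q) := by
  unfold IsWt at *
  rw [Derivation.leibniz, hp, hq]
  push_cast
  simp only [smul_eq_mul, MvPolynomial.smul_eq_C_mul, map_add]
  ring

theorem isWt_X (t : RTree) : IsWt (size t) (X t) := degD_X t

theorem isWt_one : IsWt 0 1 := by simp [IsWt]

theorem IsWt.pow {v : ℤ} {p : Forest} (hp : IsWt v p) (k : ℕ) : IsWt (k * v) (p ^ k) := by
  induction k with
  | zero => simpa using isWt_one
  | succ k ih =>
    have := ih.mul hp
    rw [← pow_succ] at this
    convert this using 1
    push_cast; ring

theorem isWt_monomial (m : RTree →₀ ℕ) : IsWt (Finsupp.weight size m : ℕ) (monomial m 1) := by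
  induction m using Finsupp.induction_linear with
  | zero => simpa using isWt_one
  | add f g hf hg =>
    have := hf.mul hg
    rw [monomial_mul, one_mul] at this
    convert this using 1
    simp
  | single t k =>
    have := (isWt_X t).pow k
    rw [X_pow_eq_monomial] at this
    convert this using 1
    simp [Finsupp.weight_single]

theorem coeff_degD (m : RTree →₀ ℕ) (p : Forest) :
    coeff m (degD p) = ((Finsupp.weight size m : ℕ) : ℂ) * coeff m p := by
  classical
  have : lcoeff ℂ m ∘ₗ (degD : Forest →ₗ[ℂ] Forest) =
      ((Finsupp.weight size m : ℕ) : ℂ) • lcoeff ℂ m :=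
    (basisMonomials RTree ℂ).ext fun k => by
      have h := isWt_monomial k
      rw [coe_basisMonomials, LinearMap.comp_apply, Derivation.coeFn_coe, h]
      simp only [lcoeff_apply, coeff_smul, LinearMap.smul_apply, coeff_monomial, smul_eq_mul]
      split_ifs with hk
      · rw [hk]; simp
      · simp
  exact LinearMap.congr_fun this p

/-- Monomials are eigenvectors of `degD` with eigenvalues in ℕ. -/
theorem IsWt.eq_zero {w : ℤ} (hw : w < 0) {p : Forest} (h : IsWt w p) : p = 0 := by
  ext m
  have h1 := congrArg (coeff m) h
  rw [coeff_degD, coeff_smul, smul_eq_mul, mul_eq_mul_right_iff] at h1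
  refine h1.resolve_left fun h2 => ?_
  have h3 : ((Finsupp.weight size m : ℕ) : ℤ) = w := by exact_mod_cast h2
  omega

theorem IsWt.act {n w : ℤ} {x : Alg} (hx : x ∈ wt n) {p : Forest} (hp : IsWt w p) :
    IsWt (w + n) (act x p) := by
  have h : InsElim.act ⁅d, x⁆ p = (n : ℂ) • InsElim.act x p := by
    rw [show ⁅d, x⁆ = (n : ℂ) • x from hx, map_smul, Derivation.smul_apply]
  rw [act_lie, act_d, Derivation.commutator_apply, hp, Derivation.map_smul] at h
  unfold IsWt
  rw [sub_eq_iff_eq_add.1 h, ← add_smul]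
  push_cast
  rw [add_comm]

theorem IsWt.tw {n w : ℤ} {x : Alg} (hx : x ∈ wt n) {p : Forest} (hp : IsWt w p) :
    IsWt (w + n) (tw x p) := by
  have h := tw_lie d x p
  rw [show ⁅d, x⁆ = (n : ℂ) • x from hx, map_smul, act_d, tw_d, hp] at h
  simp only [LinearMap.id_apply, map_smul, LinearMap.smul_apply] at h
  unfold IsWt
  push_cast
  rw [add_smul]
  linear_combination -h

theorem IsWt.forestAct {n w : ℤ} {x : Alg} (hx : x ∈ wt n) {p : Forest} (hp : IsWt w p) :
    IsWt (w + n) (forestAct x p) := by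
  have h1 := hp.act hx
  have h2 := hp.tw hx
  unfold IsWt at *
  rw [forestAct_apply, map_add, h1, h2, smul_add]

/-- Joining adds one vertex: `forestAct d` is `degD` plus the identity. This shift by one is what
makes the weight arguments below strict. -/
theorem isWt_of_join {w : ℤ} {p : Forest} (h : IsWt w (join p)) : IsWt (w - 1) p := by
  have h1 := act_join d p
  rw [act_d, h, ← map_smul] at h1
  have h2 := join_injective h1
  rw [forestAct_apply, act_d, tw_d, LinearMap.id_apply] at h2
  unfold IsWt
  push_cast
  rw [sub_smul, one_smul, h2, add_sub_cancel_right]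

theorem exists_join_eq_X (t : RTree) : ∃ p, join p = X t ∧ IsWt (size t - 1) p := by
  have h : join (monomial (kidsEquiv t) 1) = X t := by
    rw [join_monomial, Equiv.symm_apply_apply]
  exact ⟨_, h, isWt_of_join (h ▸ isWt_X t)⟩

/-! ### Commuting elements of negative degree -/

/-- Integration by parts. -/
theorem exists_antiderivative {R : Type*} [CommRing R] [Algebra ℂ R] (δ η : Derivation ℂ R R)
    (hc : ∀ p, δ (η p) = η (δ p)) {ξ : R} (h1 : δ ξ = 1) (h2 : η ξ = 0) (N : ℕ) :
    ∀ u, η u = 0 → δ^[N] u = 0 → ∀ k : ℕ, ∃ q, δ q = ξ ^ k * u ∧ η q = 0 := by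
  induction N with
  | zero => exact fun u _ hu k => ⟨0, by rw [show u = 0 from hu]; simp, map_zero _⟩
  | succ N ih =>
    intro u hu hN k
    -- The primitive of ξ^k u is ξ^(k+1) u / (k+1) minus a primitive of ξ^(k+1) δu / (k+1). The
    -- power of ξ grows while the nilpotency order of u drops, so the induction needs every k.
    obtain ⟨q, hq, hq'⟩ := ih (δ u) (by rw [← hc, hu, map_zero]) hN (k + 1)
    have hk : (k + 1 : ℂ) ≠ 0 := Nat.cast_add_one_ne_zero k
    refine ⟨((k : ℂ) + 1)⁻¹ • (ξ ^ (k + 1) * u - q), ?_, ?_⟩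
    · rw [Derivation.map_smul, inv_smul_eq_iff₀ hk, map_sub, hq, Derivation.leibniz,
        Derivation.leibniz_pow, h1]
      have : ((k : ℂ) + 1) • (ξ ^ k * u) = (k + 1) • (ξ ^ k * u) := by
        rw [← Nat.cast_smul_eq_nsmul ℂ]; push_cast; rfl
      rw [this]
      simp
      ring
    · rw [Derivation.map_smul, map_sub, hq', Derivation.leibniz, Derivation.leibniz_pow, h2, hu]
      simp

/-- In negative degree only the D⁻ vectors occur, and their twists are partial derivatives. So
`forestAct x` is then a derivation as well. -/
theorem exists_derivation {n : ℤ} (hn : n < 0) {x : Alg} (hx : x ∈ wt n) :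
    ∃ D : Derivation ℂ Forest Forest, (∀ p, tw x p = D p) ∧
      ∀ t, D (X t) = C (basis.repr x (.minus t)) := by
  classical
  have h : x ∈ Submodule.span ℂ (basis '' {i | i.deg < 0}) :=
    basis.mem_span_image.2 fun i hi => by
      have := mem_wt_iff.1 hx i (Finsupp.mem_support_iff.1 hi)
      exact this.trans_lt hn
  clear hx
  induction h using Submodule.span_induction with
  | zero => exact ⟨0, by simp, by simp⟩
  | add x y _ _ hx hy =>
    obtain ⟨D, h1, h2⟩ := hx
    obtain ⟨D', h1', h2'⟩ := hy
    exact ⟨D + D', by simp [h1, h1'], by simp [h2, h2']⟩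
  | smul c x _ hx =>
    obtain ⟨D, h1, h2⟩ := hx
    exact ⟨c • D, by simp [h1], by simp [h2, MvPolynomial.smul_eq_C_mul]⟩
  | mem x hx =>
    obtain ⟨i, hi, rfl⟩ := hx
    rcases i with _ | t | t
    · exact absurd hi (by simp [Idx.deg])
    · exact absurd hi (by simp [Idx.deg])
    · refine ⟨pderiv t, fun p => by rw [tw_basis]; rfl, fun s => ?_⟩
      rw [pderiv_X, Pi.single_apply, Module.Basis.repr_self, Finsupp.single_apply]
      by_cases hs : s = t
      · simp [hs]
      · simp [hs, Ne.symm hs]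

theorem eq_zero_of_repr_minus {n : ℤ} (hn : n < 0) {x : Alg} (hx : x ∈ wt n)
    (h : ∀ t, basis.repr x (.minus t) = 0) : x = 0 := by
  refine basis.ext_elem fun i => ?_
  by_contra h0
  rw [map_zero, Finsupp.zero_apply] at h0
  have h1 := mem_wt_iff.1 hx i h0
  rcases i with _ | t | t
  · simp only [Idx.deg] at h1; omega
  · simp only [Idx.deg] at h1; omega
  · exact h0 (h t)

/-- Each application lowers the weight by at least one, until it is negative. -/
theorem forestAct_iterate_eq_zero {n w : ℤ} (hn : n < 0) {x : Alg} (hx : x ∈ wt n) {u : Forest}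
    (hu : IsWt w u) : (forestAct x)^[w.toNat + 1] u = 0 := by
  have h : ∀ k : ℕ, IsWt (w + k * n) ((forestAct x)^[k] u) := fun k => by
    induction k with
    | zero => simpa using hu
    | succ k ih =>
      rw [Function.iterate_succ_apply']
      convert ih.forestAct hx using 1
      push_cast; ring
  refine (h _).eq_zero ?_
  push_cast
  nlinarith [Int.self_le_toNat w, mul_nonneg (Int.natCast_nonneg w.toNat) (by omega : 0 ≤ -1 - n)]

/-- Put S = `forestAct x` and T = `forestAct y`, commuting derivations, and let D, E be the twists
of x, y. Commutation forces E(join(S q)) = D(join(T q)) for all q. Each tree r in the support of y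
is `join u` with T u = 0; solving S q = u, T q = 0 makes E(X r), the coefficient of y at r, equal to
0. -/
theorem eq_zero_of_commute {m n : ℤ} (hm : 0 < m) (hmn : m ≤ n) {x y : Alg} (hx : x ∈ wt (-m))
    (hy : y ∈ wt (-n)) (hxy : ⁅x, y⁆ = 0) {t : RTree} (ht : basis.repr x (.minus t) ≠ 0)
    (ht' : basis.repr y (.minus t) = 0) : y = 0 := by
  obtain ⟨D, hD, hDX⟩ := exists_derivation (by omega) hx
  obtain ⟨E, hE, hEX⟩ := exists_derivation (by omega) hy
  set a := basis.repr x (.minus t) with ha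
  have hsize : (size t : ℤ) = m := by
    have := mem_wt_iff.1 hx _ ht
    simp only [Idx.deg] at this; omega
  have hS : ∀ p, (act x + D) p = forestAct x p := fun p => by
    rw [Derivation.add_apply, forestAct_apply, hD]
  have hT : ∀ p, (act y + E) p = forestAct y p := fun p => by
    rw [Derivation.add_apply, forestAct_apply, hE]
  have hcomm : ∀ p, forestAct x (forestAct y p) = forestAct y (forestAct x p) := fun p => by
    have := forestAct_lie x y p
    rw [hxy] at this
    rw [← sub_eq_zero, ← this]
    simp [forestAct_apply]
  obtain ⟨v, hv, hvw⟩ := exists_join_eq_X t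
  -- X t = `join v` with v of weight m - 1, so `forestAct x v` has weight -1 and vanishes; only the
  -- twist contributes, with value a. For y the weight is m - 1 - n < 0, and the twist vanishes at t
  -- by assumption.
  have hξ1 : (act x + D) (a⁻¹ • X t) = 1 := by
    rw [Derivation.map_smul, Derivation.add_apply, hDX, ← hv, act_join,
      (hvw.forestAct hx).eq_zero (by omega), map_zero, zero_add, MvPolynomial.smul_eq_C_mul,
      ← C_mul, inv_mul_cancel₀ ht, C_1]
  have hξ2 : (act y + E) (a⁻¹ • X t) = 0 := by
    rw [Derivation.map_smul, Derivation.add_apply, hEX, ht', ← hv, act_join,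
      (hvw.forestAct hy).eq_zero (by omega), map_zero, map_zero, add_zero, smul_zero]
  -- A twist sends linear forms, hence everything in the image of `join`, to constants, which all
  -- derivations kill. Only two terms of `tw_lie` survive in `hrel`.
  have hconst : ∀ z, ∀ F : Derivation ℂ Forest Forest, ∀ f : RTree → ℂ,
      (∀ r, F (X r) = C (f r)) → ∃ c, F (join z) = C c := by
    intro z F f hF
    induction z using MvPolynomial.induction_on' with
    | monomial k c =>
      refine ⟨c * f (kidsEquiv.symm k), ?_⟩
      rw [show monomial k c = c • monomial k (1 : ℂ) by simp [smul_monomial], map_smul,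
        join_monomial, Derivation.map_smul, hF, MvPolynomial.smul_eq_C_mul, C_mul]
    | add p q hp hq =>
      obtain ⟨c, hc⟩ := hp
      obtain ⟨c', hc'⟩ := hq
      exact ⟨c + c', by rw [map_add, map_add, hc, hc', C_add]⟩
  have hrel : ∀ q, E (join (forestAct x q)) = D (join (forestAct y q)) := fun q => by
    obtain ⟨c, hc⟩ := hconst q D _ hDX
    obtain ⟨c', hc'⟩ := hconst q E _ hEX
    have h := tw_lie x y (join q)
    simp only [hxy, hD, hE, hc, hc', act_join] at h
    simp only [map_zero, LinearMap.zero_apply, derivation_C, add_zero, sub_zero, zero_sub] at h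
    linear_combination h
  refine eq_zero_of_repr_minus (by omega) hy fun r => ?_
  by_contra hr
  obtain ⟨u, hu, huw⟩ := exists_join_eq_X r
  have hr' := mem_wt_iff.1 hy _ hr
  simp only [Idx.deg] at hr'
  have hyu : forestAct y u = 0 := (huw.forestAct hy).eq_zero (by omega)
  -- S is nilpotent on u by weight, so u itself, the case of exponent 0, has a primitive killed by
  -- T.
  obtain ⟨q, hq, hq'⟩ := exists_antiderivative (act x + D) (act y + E)
    (fun p => by rw [hS, hT, hT, hS, hcomm]) hξ1 hξ2 _ u (by rw [hT, hyu])
    (by rw [show ⇑(act x + D) = ⇑(forestAct x) from funext hS]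
        exact forestAct_iterate_eq_zero (by omega) hx huw) 0
  have h := hrel q
  rw [← hS, hq, ← hT, hq', pow_zero, one_mul, hu, hEX, map_zero, map_zero] at h
  exact hr (by simpa using h)

theorem exists_repr_minus {n : ℤ} (hn : n < 0) {x : Alg} (hx : x ∈ wt n) (h : x ≠ 0) :
    ∃ t, basis.repr x (.minus t) ≠ 0 := by
  by_contra! h0
  exact h (eq_zero_of_repr_minus hn hx h0)

/-- Choose t in the support of x. If y also involves t, the degrees agree, and subtracting a
multiple of x removes the coefficient at t; `eq_zero_of_commute` applies in either case. -/
theorem exists_smul_of_commute {m n : ℤ} (hm : 0 < m) (hmn : m ≤ n) {x y : Alg}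
    (hx : x ∈ wt (-m)) (hy : y ∈ wt (-n)) (hxy : ⁅x, y⁆ = 0) (h : x ≠ 0) : ∃ c : ℂ, y = c • x := by
  obtain ⟨t, ht⟩ := exists_repr_minus (by omega) hx h
  by_cases h0 : basis.repr y (.minus t) = 0
  · exact ⟨0, by rw [eq_zero_of_commute hm hmn hx hy hxy ht h0, zero_smul]⟩
  · have hn : n = m := by
      have h1 := mem_wt_iff.1 hx _ ht
      have h2 := mem_wt_iff.1 hy _ h0
      omega
    subst hn
    refine ⟨basis.repr y (.minus t) / basis.repr x (.minus t), sub_eq_zero.1 ?_⟩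
    refine eq_zero_of_commute hm le_rfl hx (sub_mem hy (Submodule.smul_mem _ _ hx)) ?_ ht ?_
    · rw [lie_sub, lie_smul, lie_self, hxy, smul_zero, sub_zero]
    · rw [map_sub, map_smul, Finsupp.sub_apply, Finsupp.smul_apply, smul_eq_mul,
        div_mul_cancel₀ _ ht, sub_self]

theorem commProp_neg : CommProp (-1) := by
  intro m n hm hn x hx y hy hxy h
  rw [neg_one_mul] at hx hy
  rcases le_total m n with hmn | hmn
  · exact exists_smul_of_commute hm hmn hx hy hxy h
  · by_cases hy0 : y = 0
    · exact ⟨0, by rw [hy0, zero_smul]⟩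
    · obtain ⟨c, rfl⟩ := exists_smul_of_commute hn hmn hy hx (by rw [← lie_skew, hxy, neg_zero]) hy0
      have hc : c ≠ 0 := fun hc => h (by rw [hc, zero_smul])
      exact ⟨c⁻¹, by rw [smul_smul, inv_mul_cancel₀ hc, one_smul]⟩

/-! ### Commuting elements of positive degree -/

theorem homogeneousComponent_map (T : Forest →ₗ[ℂ] Forest) (e : ℕ)
    (hT : ∀ j p, p.IsHomogeneous j → (T p).IsHomogeneous (j + e)) (k : ℕ) (p : Forest) :
    homogeneousComponent (k + e) (T p) = T (homogeneousComponent k p) := by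
  conv_lhs => rw [← sum_homogeneousComponent p, map_sum, map_sum]
  rw [Finset.sum_congr rfl (g := fun i => if i = k then T (homogeneousComponent k p) else 0)
    fun i _ => ?_]
  · rw [Finset.sum_ite_eq']
    split_ifs with hk
    · rfl
    · rw [homogeneousComponent_eq_zero _ _ (by simpa using hk), map_zero]
  · rw [homogeneousComponent_of_mem (hT i _ (homogeneousComponent_isHomogeneous i p))]
    simp only [Nat.add_right_cancel_iff, eq_comm (a := k)]
    split_ifs with h
    · rw [h]
    · rfl

theorem isHomogeneous_derivation {D : Derivation ℂ Forest Forest}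
    (hD : ∀ t, (D (X t)).IsHomogeneous 1) {j : ℕ} {p : Forest} (hp : p.IsHomogeneous j) :
    (D p).IsHomogeneous j := by
  have key : ∀ m : RTree →₀ ℕ, (D (monomial m 1)).IsHomogeneous m.degree := by
    intro m
    induction m using Finsupp.induction_linear with
    | zero =>
      rw [show (monomial 0 (1 : ℂ) : Forest) = 1 from rfl, Derivation.map_one_eq_zero]
      exact isHomogeneous_zero _ _ _
    | add f g hf hg =>
      rw [show (monomial (f + g) (1 : ℂ) : Forest) = monomial f 1 * monomial g 1 by
        rw [monomial_mul, one_mul], Derivation.leibniz, map_add]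
      refine ((isHomogeneous_monomial 1 rfl).mul hg).add ?_
      rw [add_comm]
      exact (isHomogeneous_monomial 1 rfl).mul hf
    | single t k =>
      rw [← X_pow_eq_monomial, Derivation.leibniz_pow, Finsupp.degree_single]
      rcases k with _ | k
      · rw [zero_smul]; exact isHomogeneous_zero _ _ _
      · rw [← Nat.cast_smul_eq_nsmul ℂ]
        exact Submodule.smul_mem (homogeneousSubmodule RTree ℂ (k + 1)) _
          ((isHomogeneous_X_pow t k).mul (hD t))
  rw [p.as_sum, map_sum]
  refine IsHomogeneous.sum _ _ _ fun m hm => ?_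
  rw [show monomial m (coeff m p) = coeff m p • monomial m (1 : ℂ) by simp [smul_monomial],
    Derivation.map_smul]
  have h1 := key m
  rw [show m.degree = j from by_contra fun h => mem_support_iff.1 hm (hp.coeff_eq_zero h)] at h1
  exact Submodule.smul_mem (homogeneousSubmodule RTree ℂ j) _ h1

theorem isHomogeneous_join (p : Forest) : (join p).IsHomogeneous 1 := by
  rw [p.as_sum, map_sum]
  refine IsHomogeneous.sum _ _ _ fun m _ => ?_
  rw [show monomial m (coeff m p) = coeff m p • monomial m (1 : ℂ) by simp [smul_monomial],
    map_smul, join_monomial]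
  exact Submodule.smul_mem (homogeneousSubmodule RTree ℂ 1) _ (isHomogeneous_X ℂ _)

/-- Polynomial degree counts trees, not vertices. `act x` maps a tree to something in the image of
`join`, that is, to a linear form, and so preserves the number of trees. -/
theorem isHomogeneous_act (x : Alg) {j : ℕ} {p : Forest} (hp : p.IsHomogeneous j) :
    (act x p).IsHomogeneous j := isHomogeneous_derivation (fun t => by
  obtain ⟨u, hu, -⟩ := exists_join_eq_X t
  rw [← hu, act_join]
  exact isHomogeneous_join _) hp

theorem tw_eq_mul {n : ℤ} (hn : 0 < n) {x : Alg} (hx : x ∈ wt n) :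
    (∀ p, tw x p = tw x 1 * p) ∧ ∃ u, tw x 1 = join u := by
  have h : x ∈ Submodule.span ℂ (basis '' {i | 0 < i.deg}) :=
    basis.mem_span_image.2 fun i hi => by
      have := mem_wt_iff.1 hx i (Finsupp.mem_support_iff.1 hi)
      exact hn.trans_eq this.symm
  clear hx
  induction h using Submodule.span_induction with
  | zero => exact ⟨by simp, 0, by simp⟩
  | add x y _ _ hx hy =>
    obtain ⟨h1, u, hu⟩ := hx
    obtain ⟨h2, v, hv⟩ := hy
    exact ⟨fun p => by simp only [map_add, LinearMap.add_apply, h1 p, h2 p, add_mul],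
      u + v, by rw [map_add, map_add, LinearMap.add_apply, hu, hv]⟩
  | smul c x _ hx =>
    obtain ⟨h1, u, hu⟩ := hx
    exact ⟨fun p => by simp only [map_smul, LinearMap.smul_apply, h1 p, smul_mul_assoc],
      c • u, by rw [map_smul, map_smul, LinearMap.smul_apply, hu]⟩
  | mem x hx =>
    obtain ⟨i, hi, rfl⟩ := hx
    rcases i with _ | t | t
    · exact absurd hi (by simp [Idx.deg])
    · obtain ⟨u, hu, -⟩ := exists_join_eq_X t
      refine ⟨fun p => ?_, u, ?_⟩ <;> rw [tw_basis]
      · simp [twB, mulX_apply]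
      · simp [twB, mulX_apply, hu]
    · exact absurd hi (by simp [Idx.deg])

theorem eq_zero_of_tw_one {n : ℤ} (hn : 0 < n) {x : Alg} (hx : x ∈ wt n) (h : tw x 1 = 0) :
    x = 0 := by
  refine basis.ext_elem fun i => ?_
  by_contra h0
  rw [map_zero, Finsupp.zero_apply] at h0
  have h1 := mem_wt_iff.1 hx i h0
  rcases i with _ | t | t
  · simp only [Idx.deg] at h1; omega
  · have := coeff_tw_plus t x
    rw [h, coeff_zero] at this
    exact h0 this.symm
  · simp only [Idx.deg] at h1; omega

/-- A nonzero linear form is prime. -/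
theorem prime_of_isHomogeneous_one {A : Forest} (hA : A.IsHomogeneous 1) (h : A ≠ 0) :
    Prime A := by
  refine (irreducible_of_totalDegree_eq_one (hA.totalDegree h) fun x hx => ?_).prime
  obtain ⟨m, hm⟩ := MvPolynomial.ne_zero_iff.1 h
  exact isUnit_iff_ne_zero.2 fun h0 => hm (by simpa [h0] using hx m)

theorem exists_smul_of_dvd {A B : Forest} (hA : A.IsHomogeneous 1) (hB : B.IsHomogeneous 1)
    (hB0 : B ≠ 0) (h : A ∣ B) : ∃ c : ℂ, B = c • A := by
  obtain ⟨R, rfl⟩ := h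
  have h1 := left_ne_zero_of_mul hB0
  have h2 := right_ne_zero_of_mul hB0
  have h3 := totalDegree_mul_of_isDomain h1 h2
  rw [hB.totalDegree hB0, hA.totalDegree h1] at h3
  refine ⟨coeff 0 R, ?_⟩
  rw [(totalDegree_eq_zero_iff_eq_C (p := R)).1 (by omega)]
  simp [MvPolynomial.smul_eq_C_mul, mul_comm]

/-- For p ≠ 0 the quotient is homogeneous of the negative weight w - v. -/
theorem IsWt.eq_zero_of_dvd {v w : ℤ} (hvw : w < v) {p q : Forest} (hp : IsWt v p)
    (hq : IsWt w q) (h : p ∣ q) : q = 0 := by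
  obtain ⟨r, rfl⟩ := h
  by_cases hp0 : p = 0
  · rw [hp0, zero_mul]
  have hr : IsWt (w - v) r := by
    unfold IsWt at *
    refine mul_left_cancel₀ hp0 ?_
    rw [Derivation.leibniz, hp] at hq
    push_cast
    simp only [smul_eq_mul, MvPolynomial.smul_eq_C_mul, map_sub] at hq ⊢
    linear_combination hq
  rw [hr.eq_zero (by omega), mul_zero]

theorem IsWt.homogeneousComponent {w : ℤ} {p : Forest} (hp : IsWt w p) (k : ℕ) :
    IsWt w (homogeneousComponent k p) := by
  classical
  unfold IsWt at *
  ext m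
  have h := congrArg (coeff m) hp
  rw [coeff_degD, coeff_smul] at *
  rw [coeff_homogeneousComponent]
  split_ifs
  · exact h
  · simp

theorem commProp_one : CommProp 1 := by
  intro m n hm hn x hx y hy hxy hx0
  rw [one_mul] at hx hy
  obtain ⟨hA, P, hP⟩ := tw_eq_mul hm hx
  obtain ⟨hB, Q, hQ⟩ := tw_eq_mul hn hy
  set A := tw x 1 with hAdef
  set B := tw y 1 with hBdef
  have hA0 : A ≠ 0 := fun h => hx0 (eq_zero_of_tw_one hm hx h)
  have hA1 : A.IsHomogeneous 1 := hP ▸ isHomogeneous_join P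
  have hB1 : B.IsHomogeneous 1 := hQ ▸ isHomogeneous_join Q
  have hAw : IsWt m A := by simpa using isWt_one.tw hx
  have hBw : IsWt n B := by simpa using isWt_one.tw hy
  have hPw : IsWt (m - 1) P := isWt_of_join (hP ▸ hAw)
  have hQw : IsWt (n - 1) Q := isWt_of_join (hQ ▸ hBw)
  by_cases hB0 : B = 0
  · exact ⟨0, by rw [eq_zero_of_tw_one hn hy hB0, zero_smul]⟩
  by_cases hAB : A ∣ B
  · obtain ⟨c, hc⟩ := exists_smul_of_dvd hA1 hB1 hB0 hAB
    have hmn : m = n := by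
      by_contra hmn
      have h1 : IsWt m B := by
        unfold IsWt at hAw ⊢
        rw [hc, Derivation.map_smul, hAw, smul_comm]
      unfold IsWt at hBw h1
      rw [h1] at hBw
      exact hmn (by exact_mod_cast smul_left_injective ℂ hB0 hBw)
    subst hmn
    refine ⟨c, sub_eq_zero.1 (eq_zero_of_tw_one hm (sub_mem hy (Submodule.smul_mem _ c hx)) ?_)⟩
    rw [map_sub, map_smul, LinearMap.sub_apply, LinearMap.smul_apply, ← hAdef, ← hBdef, hc,
      sub_self]
  exfalso
  have hBA : ¬ B ∣ A := fun h => by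
    obtain ⟨c, hc⟩ := exists_smul_of_dvd hB1 hA1 hA0 h
    have hc0 : c ≠ 0 := fun h => hA0 (by rw [hc, h, zero_smul])
    exact hAB ⟨C c⁻¹, by
      rw [hc, MvPolynomial.smul_eq_C_mul, mul_right_comm, ← C_mul, mul_inv_cancel₀ hc0, C_1,
        one_mul]⟩
  -- Evaluating `tw_lie` at 1 leaves act x B = act y A, because derivations kill 1 and
  -- multiplications commute. Pull this back along `join`.
  have hrel : act x Q + A * Q = act y P + B * P := join_injective (by
    have h := tw_lie x y 1
    rw [hxy, map_zero, LinearMap.zero_apply, hA B, hB A, ← hAdef, ← hBdef] at h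
    simp only [Derivation.map_one_eq_zero, map_zero] at h
    have h1 := act_join x Q
    have h2 := act_join y P
    rw [forestAct_apply, hA] at h1
    rw [forestAct_apply, hB] at h2
    rw [← h1, ← h2, ← hP, ← hQ]
    linear_combination -h)
  -- k is the larger of the two total degrees. In degree k + 1 the terms from `act` disappear, and A
  -- Q_k = B P_k remains.
  obtain ⟨k, hk1, hk2, hk3⟩ : ∃ k, P.totalDegree ≤ k ∧ Q.totalDegree ≤ k ∧
      (homogeneousComponent k Q ≠ 0 ∨ homogeneousComponent k P ≠ 0) := by
    have hne : ∀ R : Forest, R ≠ 0 → homogeneousComponent R.totalDegree R ≠ 0 := by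
      intro R hR h0
      obtain ⟨m, hm', hm⟩ := Finset.exists_mem_eq_sup R.support (support_nonempty.2 hR)
        (fun s => s.sum fun _ e => e)
      rw [mem_support_iff] at hm'
      have := congrArg (coeff m) h0
      classical
      rw [coeff_homogeneousComponent, coeff_zero, if_pos
        (show m.degree = R.totalDegree by rw [totalDegree, hm]; rfl)] at this
      exact hm' this
    have hP0 : P ≠ 0 := fun h => hA0 (by rw [hP, h, map_zero])
    have hQ0 : Q ≠ 0 := fun h => hB0 (by rw [hQ, h, map_zero])
    rcases le_total P.totalDegree Q.totalDegree with h | h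
    · exact ⟨_, h, le_rfl, .inl (hne Q hQ0)⟩
    · exact ⟨_, le_rfl, h, .inr (hne P hP0)⟩
  have htop := congrArg (homogeneousComponent (k + 1)) hrel
  have hact : ∀ (z : Alg) (R : Forest), R.totalDegree ≤ k →
      homogeneousComponent (k + 1) (act z R) = 0 := fun z R hR => by
    have := homogeneousComponent_map (act z : Forest →ₗ[ℂ] Forest) 0
      (fun j p hp => isHomogeneous_act z hp) (k + 1) R
    rw [homogeneousComponent_eq_zero _ R (by omega), map_zero] at this
    exact this
  have hmul : ∀ L R : Forest, L.IsHomogeneous 1 →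
      homogeneousComponent (k + 1) (L * R) = L * homogeneousComponent k R := fun L R hL =>
    homogeneousComponent_map (LinearMap.mulLeft ℂ L) 1
      (fun j p hp => by rw [add_comm]; exact hL.mul hp) k R
  rw [map_add, map_add, hact x Q hk2, hact y P hk1, hmul A Q hA1, hmul B P hB1, zero_add,
    zero_add] at htop
  -- The prime B divides A Q_k but not A, so it divides Q_k; but Q_k has weight n - 1, less than the
  -- weight n of B. The same argument kills P_k.
  have h1 : homogeneousComponent k Q = 0 := by
    refine hBw.eq_zero_of_dvd (by omega) (hQw.homogeneousComponent k) ?_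
    exact ((prime_of_isHomogeneous_one hB1 hB0).dvd_or_dvd (htop ▸ dvd_mul_right B _)).resolve_left
      hBA
  have h2 : homogeneousComponent k P = 0 := by
    refine hAw.eq_zero_of_dvd (by omega) (hPw.homogeneousComponent k) ?_
    exact ((prime_of_isHomogeneous_one hA1 hA0).dvd_or_dvd
      (htop ▸ dvd_mul_right A _)).resolve_left hAB
  exact hk3.elim (· h1) (· h2)

/-! ### The dimension bound -/

open Module

theorem commProp {ε : ℤ} (hε : ε * ε = 1) : CommProp ε := by
  rcases mul_self_eq_one_iff.1 hε with rfl | rfl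
  · exact commProp_one
  · exact commProp_neg

theorem finrank_le_of_sub_smul_mem {U V : Submodule ℂ Alg} [FiniteDimensional ℂ U] {x : Alg}
    (hx : x ∈ U) (h : ∀ z ∈ U, ∃ c : ℂ, z - c • x ∈ V) :
    finrank ℂ U ≤ finrank ℂ (U ⊓ V : Submodule ℂ Alg) + 1 := by
  have h1 : U ≤ (U ⊓ V) ⊔ Submodule.span ℂ {x} := fun z hz => by
    obtain ⟨c, hc⟩ := h z hz
    rw [← sub_add_cancel z (c • x)]
    exact Submodule.add_mem_sup ⟨sub_mem hz (U.smul_mem c hx), hc⟩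
      (Submodule.smul_mem _ c (Submodule.mem_span_singleton_self x))
  have h2 := Submodule.finrank_mono h1
  have h3 := Submodule.finrank_add_le_finrank_add_finrank (U ⊓ V) (Submodule.span ℂ {x})
  have h4 := finrank_span_le_card (R := ℂ) ({x} : Set Alg)
  simp only [Set.toFinset_singleton, Finset.card_singleton] at h4
  omega

theorem mem_fil_neg_one {ε : ℤ} (hε : ε * ε = 1) {x : Alg} (hx : x ∈ fil ε 0)
    (h : basis.repr x .d = 0) : x ∈ fil ε (-1) := mem_fil.2 fun i hi => by
  have h1 := mem_fil.1 hx i hi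
  have h2 : i.deg ≠ 0 := by
    rcases i with _ | t | t
    · exact absurd h hi
    · have := one_le_size t
      simp only [Idx.deg]; omega
    · have := one_le_size t
      simp only [Idx.deg]; omega
  have h3 : ε ≠ 0 := fun h => by simp [h] at hε
  have := mul_ne_zero h3 h2
  omega

theorem mem_wt_zero_of_mem_fil {x : Alg} (h : x ∈ fil 1 0) (h' : x ∈ fil (-1) 0) : x ∈ wt 0 :=
  mem_wt_iff.2 fun i hi => by
    have h1 := mem_fil.1 h i hi
    have h2 := mem_fil.1 h' i hi
    omega

theorem eq_zero_of_mem_fil {ε : ℤ} {x : Alg} (h : x ∈ fil ε (-1)) (h' : x ∈ fil (-ε) 0) :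
    x = 0 := by
  refine basis.ext_elem fun i => ?_
  by_contra h0
  rw [map_zero, Finsupp.zero_apply] at h0
  have h1 := mem_fil.1 h i h0
  have h2 := mem_fil.1 h' i h0
  rw [neg_mul] at h2
  omega

section FiniteDimensional

variable {ε : ℤ} (hε : ε * ε = 1) (s : LieSubalgebra ℂ Alg) [FiniteDimensional ℂ s]

include hε

theorem finrank_le_fil_zero :
    finrank ℂ s ≤ finrank ℂ (s.toSubmodule ⊓ fil ε 0 : Submodule ℂ Alg) + 1 := by
  obtain ⟨x, hx, h⟩ := exists_sub_smul_mem_fil hε (commProp hε) s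
  have : FiniteDimensional ℂ s.toSubmodule := ‹_›
  exact finrank_le_of_sub_smul_mem hx h

/-- The degree 0 component is spanned by `d`, so the `d`-coordinate alone separates `fil ε 0` from
`fil ε (-1)`. -/
theorem finrank_fil_zero_le :
    finrank ℂ (s.toSubmodule ⊓ fil ε 0 : Submodule ℂ Alg) ≤
      finrank ℂ (s.toSubmodule ⊓ fil ε (-1) : Submodule ℂ Alg) + 1 := by
  have : FiniteDimensional ℂ s.toSubmodule := ‹_›
  have h0 : s.toSubmodule ⊓ fil ε 0 ⊓ fil ε (-1) = s.toSubmodule ⊓ fil ε (-1) := by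
    rw [inf_assoc, inf_eq_right.2 (fil_mono (by norm_num))]
  by_cases h : ∃ x ∈ s.toSubmodule ⊓ fil ε 0, basis.repr x .d ≠ 0
  · obtain ⟨x, hx, hxd⟩ := h
    rw [← h0]
    refine finrank_le_of_sub_smul_mem hx fun z hz =>
      ⟨basis.repr z .d / basis.repr x .d, mem_fil_neg_one hε
        (sub_mem hz.2 (Submodule.smul_mem _ _ hx.2)) ?_⟩
    rw [map_sub, map_smul, Finsupp.sub_apply, Finsupp.smul_apply, smul_eq_mul,
      div_mul_cancel₀ _ hxd, sub_self]
  · push Not at h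
    have h1 : s.toSubmodule ⊓ fil ε 0 ≤ s.toSubmodule ⊓ fil ε (-1) := fun x hx =>
      ⟨hx.1, mem_fil_neg_one hε hx.2 (h x hx)⟩
    exact (Submodule.finrank_mono h1).trans (Nat.le_succ _)

/-- Strictly negative index is closed under brackets, so `exists_sub_smul_mem_fil` applies to this
subalgebra with the opposite sign. The remainder z - c x lies in both `fil ε (-1)` and `fil (-ε) 0`,
which meet in zero. -/
theorem exists_smul_of_mem_fil_neg_one :
    ∃ x ∈ s.toSubmodule ⊓ fil ε (-1), ∀ z ∈ s.toSubmodule ⊓ fil ε (-1), ∃ c : ℂ, z = c • x := by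
  have : FiniteDimensional ℂ s.toSubmodule := ‹_›
  let s' : LieSubalgebra ℂ Alg :=
    { s.toSubmodule ⊓ fil ε (-1) with
      lie_mem' := fun {x y} hx hy => by
        change x ∈ s.toSubmodule ⊓ fil ε (-1) at hx
        change y ∈ s.toSubmodule ⊓ fil ε (-1) at hy
        exact show ⁅x, y⁆ ∈ s.toSubmodule ⊓ fil ε (-1) from
          ⟨s.lie_mem hx.1 hy.1, fil_mono (by norm_num) (lie_mem_fil hx.2 hy.2)⟩ }
  have : FiniteDimensional ℂ s' :=
    inferInstanceAs (FiniteDimensional ℂ (s.toSubmodule ⊓ fil ε (-1) : Submodule ℂ Alg))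
  have hε' : -ε * -ε = 1 := by rw [neg_mul_neg, hε]
  obtain ⟨x, hx, h⟩ := exists_sub_smul_mem_fil hε' (commProp hε') s'
  refine ⟨x, hx, fun z hz => ?_⟩
  obtain ⟨c, hc⟩ := h z hz
  exact ⟨c, sub_eq_zero.1
    (eq_zero_of_mem_fil (sub_mem hz.2 (Submodule.smul_mem _ c hx.2)) hc)⟩

theorem finrank_fil_neg_one_le :
    finrank ℂ (s.toSubmodule ⊓ fil ε (-1) : Submodule ℂ Alg) ≤ 1 := by
  obtain ⟨x, hx, h⟩ := exists_smul_of_mem_fil_neg_one hε s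
  refine finrank_le_one ⟨x, hx⟩ fun z => ?_
  obtain ⟨c, hc⟩ := h z z.2
  exact ⟨c, Subtype.ext hc.symm⟩

theorem finrank_le_three : finrank ℂ s ≤ 3 := by
  have h1 := finrank_le_fil_zero hε s
  have h2 := finrank_fil_zero_le hε s
  have h3 := finrank_fil_neg_one_le hε s
  omega

/-- The two dimension inequalities leave at least one dimension for `s ⊓ fil ε (-1)`, which is
therefore a line. It is stable under ad `d`, so its generator is an eigenvector, with the degree of
any basis vector in its support as eigenvalue. -/
theorem exists_mem_wt_of_finrank_eq_three (hs : finrank ℂ s = 3) (hd : d ∈ s) :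
    ∃ k : ℤ, ε * k < 0 ∧ ∃ x ∈ wt k, x ∈ s ∧ x ≠ 0 := by
  have : FiniteDimensional ℂ s.toSubmodule := ‹_›
  have h1 := finrank_le_fil_zero hε s
  have h2 := finrank_fil_zero_le hε s
  obtain ⟨x, hx, h⟩ := exists_smul_of_mem_fil_neg_one hε s
  have hx0 : x ≠ 0 := fun h0 => by
    have : s.toSubmodule ⊓ fil ε (-1) = ⊥ := (Submodule.eq_bot_iff _).2 fun z hz => by
      obtain ⟨c, rfl⟩ := h z hz
      rw [h0, smul_zero]
    rw [this, finrank_bot] at h2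
    omega
  obtain ⟨c, hc⟩ := h ⁅d, x⁆ ⟨s.lie_mem hd hx.1, mem_fil.2 fun i hi => by
    rw [repr_lie_d] at hi
    exact mem_fil.1 hx.2 i (right_ne_zero_of_mul hi)⟩
  obtain ⟨i, hi⟩ : ∃ i, basis.repr x i ≠ 0 := by
    by_contra! h0
    exact hx0 (basis.ext_elem fun i => by rw [h0, map_zero, Finsupp.zero_apply])
  have hci : (i.deg : ℂ) = c := by
    have := congrArg (fun z => basis.repr z i) hc
    simp only [repr_lie_d, map_smul, Finsupp.smul_apply, smul_eq_mul] at this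
    exact mul_right_cancel₀ hi this
  have := mem_fil.1 hx.2 i hi
  exact ⟨i.deg, by omega, x, by rw [← hci] at hc; exact hc, hx.1, hx0⟩

end FiniteDimensional

/-! ### Three-dimensional subalgebras -/

theorem d_mem_of_finrank_eq_three (s : LieSubalgebra ℂ Alg) [FiniteDimensional ℂ s]
    (hs : finrank ℂ s = 3) : d ∈ s := by
  have : FiniteDimensional ℂ s.toSubmodule := ‹_›
  have h1 := finrank_le_fil_zero (ε := 1) (by norm_num) s
  have h2 := finrank_le_fil_zero (ε := -1) (by norm_num) s
  have h3 := Submodule.finrank_sup_add_finrank_inf_eq (s.toSubmodule ⊓ fil 1 0)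
    (s.toSubmodule ⊓ fil (-1) 0)
  have h4 : finrank ℂ (s.toSubmodule ⊓ fil 1 0 ⊔ s.toSubmodule ⊓ fil (-1) 0 : Submodule ℂ Alg) ≤
      finrank ℂ s := Submodule.finrank_mono (sup_le inf_le_left inf_le_left)
  -- Two subspaces of dimension at least 2 in a space of dimension 3 meet nontrivially. Here the
  -- intersection has degree 0, so it consists of multiples of `d`.
  have h5 : s.toSubmodule ⊓ fil 1 0 ⊓ (s.toSubmodule ⊓ fil (-1) 0) ≠ ⊥ := fun h => by
    rw [h, finrank_bot] at h3
    omega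
  obtain ⟨z, hz, hz0⟩ := Submodule.exists_mem_ne_zero_of_ne_bot h5
  obtain ⟨c, rfl⟩ := mem_wt_zero (mem_wt_zero_of_mem_fil hz.1.2 hz.2.2)
  have hc : c ≠ 0 := fun h => hz0 (by rw [h, zero_smul])
  have := s.smul_mem c⁻¹ hz.1.1
  rwa [smul_smul, inv_mul_cancel₀ hc, one_smul] at this

theorem linearIndependent_of_wt {ι : Type} (k : ι → ℤ) (hk : Function.Injective k) (v : ι → Alg)
    (hv : ∀ i, v i ∈ wt (k i)) (h0 : ∀ i, v i ≠ 0) : LinearIndependent ℂ v :=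
  Module.End.eigenvectors_linearIndependent' (brLin d) (fun i => (k i : ℂ))
    (Int.cast_injective.comp hk) v fun i => ⟨Module.End.mem_eigenspace_iff.2 (hv i), h0 i⟩

theorem d_ne_zero : d ≠ 0 := basis.ne_zero _

theorem d_mem_wt : d ∈ wt 0 := basis_mem_wt Idx.d

theorem linearIndependent_triple {m n : ℤ} (hm : 0 < m) (hn : 0 < n) {x y : Alg} (hx : x ∈ wt m)
    (hy : y ∈ wt (-n)) (hx0 : x ≠ 0) (hy0 : y ≠ 0) : LinearIndependent ℂ ![x, d, y] := by
  refine linearIndependent_of_wt ![m, 0, -n] ?_ _ ?_ ?_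
  · intro i j
    fin_cases i <;> fin_cases j <;> simp <;> omega
  · intro i
    fin_cases i
    exacts [hx, d_mem_wt, hy]
  · intro i
    fin_cases i
    exacts [hx0, d_ne_zero, hy0]

theorem finrank_span_triple {x y z : Alg} (h : LinearIndependent ℂ ![x, y, z]) :
    finrank ℂ (Submodule.span ℂ {x, y, z}) = 3 := by
  have := finrank_span_eq_card h
  rwa [Matrix.range_cons, Matrix.range_cons, Matrix.range_cons, Matrix.range_empty,
    Set.union_empty, Fintype.card_fin] at this

theorem finrank_span_pair {x y : Alg} (h : LinearIndependent ℂ ![x, y]) :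
    finrank ℂ (Submodule.span ℂ {x, y}) = 2 := by
  have := finrank_span_eq_card h
  rwa [Matrix.range_cons, Matrix.range_cons, Matrix.range_empty,
    Set.union_empty, Fintype.card_fin] at this

theorem exists_eq_span_triple (s : LieSubalgebra ℂ Alg) [FiniteDimensional ℂ s]
    (hs : finrank ℂ s = 3) :
    ∃ m n : ℤ, 0 < m ∧ 0 < n ∧ ∃ x ∈ wt m, ∃ y ∈ wt (-n),
      LinearIndependent ℂ ![x, d, y] ∧ s.toSubmodule = Submodule.span ℂ {x, d, y} := by
  have : FiniteDimensional ℂ s.toSubmodule := ‹_›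
  have hd := d_mem_of_finrank_eq_three s hs
  obtain ⟨m, hm, x, hx, hxs, hx0⟩ :=
    exists_mem_wt_of_finrank_eq_three (ε := -1) (by norm_num) s hs hd
  obtain ⟨n, hn, y, hy, hys, hy0⟩ :=
    exists_mem_wt_of_finrank_eq_three (ε := 1) (by norm_num) s hs hd
  rw [← neg_neg n] at hy
  have hli := linearIndependent_triple (by omega) (by omega) hx hy hx0 hy0
  refine ⟨m, -n, by omega, by omega, x, hx, y, hy, hli, ?_⟩
  refine (Submodule.eq_of_le_of_finrank_eq (Submodule.span_le.2 ?_) ?_).symm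
  · rintro z (rfl | rfl | rfl)
    exacts [hxs, hd, hys]
  · rw [finrank_span_triple hli]; exact hs.symm

/-! ### The two isomorphism types in dimension three -/

theorem coeffs_eq_zero {x y z : Alg} (h : LinearIndependent ℂ ![x, y, z]) {a b c : ℂ}
    (h0 : a • x + b • y + c • z = 0) : a = 0 ∧ b = 0 ∧ c = 0 := by
  have := Fintype.linearIndependent_iff.1 h ![a, b, c] (by simpa [Fin.sum_univ_three] using h0)
  exact ⟨this 0, this 1, this 2⟩

/-- A Lie algebra with basis an `sl₂`-triple is isomorphic to `sl₂`. -/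
theorem nonempty_sl_equiv {L : Type*} [LieRing L] [LieAlgebra ℂ L] {e h f : L}
    (he : ⁅h, e⁆ = (2 : ℂ) • e) (hf : ⁅h, f⁆ = -(2 : ℂ) • f) (hef : ⁅e, f⁆ = h)
    (hli : ∀ a b c : ℂ, a • e + b • h + c • f = 0 → a = 0 ∧ b = 0 ∧ c = 0)
    (hspan : ∀ z, ∃ a b c : ℂ, z = a • e + b • h + c • f) :
    Nonempty (L ≃ₗ⁅ℂ⁆ LieAlgebra.SpecialLinear.sl (Fin 2) ℂ) := by
  have htr : ∀ M : LieAlgebra.SpecialLinear.sl (Fin 2) ℂ, M.1 1 1 = -M.1 0 0 := fun M => by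
    have : M.1.trace = 0 := M.2
    rw [Matrix.trace_fin_two] at this
    linear_combination this
  have he' : ⁅e, h⁆ = -(2 : ℂ) • e := by rw [← lie_skew, he, neg_smul]
  have hf' : ⁅f, h⁆ = (2 : ℂ) • f := by rw [← lie_skew, hf, neg_smul, neg_neg]
  have hfe : ⁅f, e⁆ = -h := by rw [← lie_skew, hef]
  let φ : LieAlgebra.SpecialLinear.sl (Fin 2) ℂ →ₗ⁅ℂ⁆ L :=
    { toFun := fun M => M.1 0 1 • e + M.1 0 0 • h + M.1 1 0 • f
      map_add' := fun M N => by
        change (M.1 0 1 + N.1 0 1) • e + (M.1 0 0 + N.1 0 0) • h + (M.1 1 0 + N.1 1 0) • f = _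
        module
      map_smul' := fun c M => by
        change (c * M.1 0 1) • e + (c * M.1 0 0) • h + (c * M.1 1 0) • f = _
        simp only [RingHom.id_apply, smul_add, mul_smul]
      map_lie' := fun {M N} => by
        simp only [LieSubalgebra.coe_bracket, Ring.lie_def, Matrix.sub_apply, Matrix.mul_apply,
          Fin.sum_univ_two, htr, lie_add, add_lie, smul_lie, lie_smul, lie_self, he, hf, hef, he',
          hf', hfe]
        module }
  refine ⟨(LieEquiv.ofBijective φ ⟨?_, fun z => ?_⟩).symm⟩
  · rw [injective_iff_map_eq_zero]
    intro M hM
    obtain ⟨h1, h2, h3⟩ := hli _ _ _ hM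
    refine Subtype.ext (Matrix.ext fun i j => ?_)
    fin_cases i <;> fin_cases j
    · exact h2
    · exact h1
    · exact h3
    · exact (htr M).trans (by rw [h2]; simp)
  · obtain ⟨a, b, c, rfl⟩ := hspan z
    refine ⟨⟨!![b, a; c, -b], ?_⟩, ?_⟩
    · change Matrix.trace !![b, a; c, -b] = 0
      simp [Matrix.trace_fin_two]
    · simp [φ]

section Triple

variable {s : LieSubalgebra ℂ Alg} {m n : ℤ} (hm : 0 < m) (hn : 0 < n) {x y : Alg}
  (hx : x ∈ wt m) (hy : y ∈ wt (-n)) (hli : LinearIndependent ℂ ![x, d, y])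
  (hs : s.toSubmodule = Submodule.span ℂ {x, d, y})

include hm hn hx hy hli hs

theorem derivedSeries_of_lie_eq_zero (hxy : ⁅x, y⁆ = 0) :
    (LieAlgebra.derivedSeries ℂ s 1).toSubmodule.map s.toSubmodule.subtype =
        Submodule.span ℂ {x, y} ∧
      finrank ℂ (LieAlgebra.derivedSeries ℂ s 1) = 2 := by
  have hdx : ⁅d, x⁆ = (m : ℂ) • x := hx
  have hdy : ⁅d, y⁆ = (-(n : ℂ)) • y := by
    have : ⁅d, y⁆ = ((-n : ℤ) : ℂ) • y := hy
    rwa [Int.cast_neg] at this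
  have hmem : ∀ z, z ∈ s ↔ ∃ a b c : ℂ, a • x + b • d + c • y = z := fun z => by
    rw [← LieSubalgebra.mem_toSubmodule, hs, Submodule.mem_span_triple]
  have hxs : x ∈ s := (hmem _).2 ⟨1, 0, 0, by simp⟩
  have hds : d ∈ s := (hmem _).2 ⟨0, 1, 0, by simp⟩
  have hys : y ∈ s := (hmem _).2 ⟨0, 0, 1, by simp⟩
  have h1 : (LieAlgebra.derivedSeries ℂ s 1).toSubmodule.map s.toSubmodule.subtype =
      Submodule.span ℂ {x, y} := by
    have h2 : LieAlgebra.derivedSeries ℂ s 1 = ⁅(⊤ : LieIdeal ℂ s), (⊤ : LieIdeal ℂ s)⁆ := rfl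
    refine le_antisymm ?_ (Submodule.span_le.2 ?_)
    · rw [h2, LieSubmodule.lieIdeal_oper_eq_linear_span, Submodule.map_span_le]
      rintro _ ⟨⟨⟨u, hu⟩, -⟩, ⟨⟨v, hv⟩, -⟩, rfl⟩
      obtain ⟨a, b, c, rfl⟩ := (hmem u).1 hu
      obtain ⟨a', b', c', rfl⟩ := (hmem v).1 hv
      change ⁅a • x + b • d + c • y, a' • x + b' • d + c' • y⁆ ∈ _
      rw [Submodule.mem_span_pair]
      refine ⟨m * (b * a' - a * b'), -n * (b * c' - c * b'), ?_⟩
      have hxd : ⁅x, d⁆ = -(m : ℂ) • x := by rw [← lie_skew, hdx, neg_smul]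
      have hyd : ⁅y, d⁆ = (n : ℂ) • y := by rw [← lie_skew, hdy, neg_smul, neg_neg]
      have hyx : ⁅y, x⁆ = 0 := by rw [← lie_skew, hxy, neg_zero]
      simp only [lie_add, add_lie, smul_lie, lie_smul, lie_self, hdx, hdy, hxd, hyd, hxy, hyx]
      module
    -- An eigenvector u of ad `d` with eigenvalue c ≠ 0 is the bracket c⁻¹[d, u].
    · have hbr : ∀ (u : Alg) (hu : u ∈ s) (c : ℂ), c ≠ 0 → ⁅d, u⁆ = c • u →
          u ∈ (LieAlgebra.derivedSeries ℂ s 1).toSubmodule.map s.toSubmodule.subtype := by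
        intro u hu c hc h
        refine ⟨c⁻¹ • ⁅(⟨d, hds⟩ : s), (⟨u, hu⟩ : s)⁆, Submodule.smul_mem _ _
          (LieSubmodule.lie_mem_lie (LieSubmodule.mem_top _) (LieSubmodule.mem_top _)), ?_⟩
        change c⁻¹ • ⁅d, u⁆ = u
        rw [h, smul_smul, inv_mul_cancel₀ hc, one_smul]
      rintro z (rfl | rfl)
      · exact hbr z hxs m (by exact_mod_cast hm.ne') hdx
      · exact hbr z hys _ (neg_ne_zero.2 (by exact_mod_cast hn.ne')) hdy
  refine ⟨h1, ?_⟩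
  have h2 := hli.comp ![0, 2] (by decide)
  have h3 : ![x, d, y] ∘ ![0, 2] = ![x, y] := by
    ext i; fin_cases i <;> rfl
  rw [h3] at h2
  have h4 := finrank_span_pair h2
  rw [← h1] at h4
  rw [← h4]
  exact (LinearEquiv.finrank_eq (Submodule.equivMapOfInjective s.toSubmodule.subtype
    Subtype.val_injective _))

theorem nonempty_sl_equiv_of_lie_ne_zero (hxy : ⁅x, y⁆ ≠ 0) :
    m = n ∧ Nonempty (s ≃ₗ⁅ℂ⁆ LieAlgebra.SpecialLinear.sl (Fin 2) ℂ) := by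
  have hdx : ⁅d, x⁆ = (m : ℂ) • x := hx
  have hdy : ⁅d, y⁆ = (-(n : ℂ)) • y := by
    have : ⁅d, y⁆ = ((-n : ℤ) : ℂ) • y := hy
    rwa [Int.cast_neg] at this
  have hmem : ∀ z, z ∈ s ↔ ∃ a b c : ℂ, a • x + b • d + c • y = z := fun z => by
    rw [← LieSubalgebra.mem_toSubmodule, hs, Submodule.mem_span_triple]
  have hxs : x ∈ s := (hmem _).2 ⟨1, 0, 0, by simp⟩
  have hds : d ∈ s := (hmem _).2 ⟨0, 1, 0, by simp⟩
  have hys : y ∈ s := (hmem _).2 ⟨0, 0, 1, by simp⟩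
  have hm0 : (m : ℂ) ≠ 0 := by exact_mod_cast hm.ne'
  have hn0 : (n : ℂ) ≠ 0 := by exact_mod_cast hn.ne'
  obtain ⟨a, b, c, habc⟩ := (hmem _).1 (s.lie_mem hxs hys)
  have h1 : ⁅d, ⁅x, y⁆⁆ = ((m + -n : ℤ) : ℂ) • ⁅x, y⁆ := lie_mem_wt hx hy
  rw [← habc, lie_add, lie_add, lie_smul, lie_smul, lie_smul, lie_self, hdx, hdy] at h1
  push_cast at h1
  -- Write [x, y] = a x + b d + c y. Then ad `d` multiplies the three terms by m, 0, -n and the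
  -- whole by m - n; these coefficients are the differences.
  obtain ⟨ha, hb, hc⟩ := coeffs_eq_zero hli (a := n * a) (b := (n - m) * b) (c := -m * c) (by
    rw [← sub_eq_zero] at h1
    rw [← h1]
    module)
  have ha : a = 0 := by simpa [hn0] using ha
  have hc : c = 0 := by simpa [hm0] using hc
  rw [ha, hc, zero_smul, zero_smul, zero_add, add_zero] at habc
  have hb0 : b ≠ 0 := fun h => hxy (by rw [← habc, h, zero_smul])
  have hmn : m = n := by
    have h2 : (n : ℂ) - m = 0 := by simpa [hb0] using hb
    exact_mod_cast (sub_eq_zero.1 h2).symm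
  subst hmn
  have hy2 : (2 / (m * b) : ℂ) ≠ 0 := div_ne_zero two_ne_zero (mul_ne_zero hm0 hb0)
  have hd2 : (2 / m : ℂ) ≠ 0 := div_ne_zero two_ne_zero hm0
  -- With [x, y] = b d, the factor 2/m gives [h, e] = 2e, and then 2/(m b) is forced on y by [e, f]
  -- = h.
  refine ⟨rfl, nonempty_sl_equiv (e := (⟨x, hxs⟩ : s)) (h := (2 / m : ℂ) • (⟨d, hds⟩ : s))
    (f := (2 / (m * b) : ℂ) • (⟨y, hys⟩ : s)) (Subtype.ext ?_) (Subtype.ext ?_) (Subtype.ext ?_)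
    (fun a' b' c' h => ?_) fun z => ?_⟩
  · change ⁅(2 / m : ℂ) • d, x⁆ = (2 : ℂ) • x
    rw [smul_lie, hdx, smul_smul, div_mul_cancel₀ _ hm0]
  · change ⁅(2 / m : ℂ) • d, (2 / (m * b) : ℂ) • y⁆ = -(2 : ℂ) • (2 / (m * b) : ℂ) • y
    rw [smul_lie, lie_smul, hdy, smul_smul, smul_smul, smul_smul]
    congr 1
    field_simp
  · change ⁅x, (2 / (m * b) : ℂ) • y⁆ = (2 / m : ℂ) • d
    rw [lie_smul, ← habc, smul_smul]
    congr 1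
    field_simp
  · have h' := congrArg Subtype.val h
    change a' • x + b' • (2 / m : ℂ) • d + c' • (2 / (m * b) : ℂ) • y = 0 at h'
    rw [smul_smul, smul_smul] at h'
    obtain ⟨h1, h2, h3⟩ := coeffs_eq_zero hli h'
    exact ⟨h1, (mul_eq_zero.1 h2).resolve_right hd2, (mul_eq_zero.1 h3).resolve_right hy2⟩
  · obtain ⟨z, hz⟩ := z
    obtain ⟨a', b', c', rfl⟩ := (hmem z).1 hz
    refine ⟨a', b' / (2 / m), c' / (2 / (m * b)), Subtype.ext ?_⟩
    change _ = a' • x + (b' / (2 / m)) • (2 / m : ℂ) • d +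
      (c' / (2 / (m * b))) • (2 / (m * b) : ℂ) • y
    rw [smul_smul, smul_smul, div_mul_cancel₀ _ hd2, div_mul_cancel₀ _ hy2]

end Triple

/-! ### Examples in dimensions two and three -/

/-- The span of a set that contains the brackets of its elements up to linear combinations. -/
def spanSubalgebra (T : Set Alg) (h : ∀ x ∈ T, ∀ y ∈ T, ⁅x, y⁆ ∈ Submodule.span ℂ T) :
    LieSubalgebra ℂ Alg :=
  { Submodule.span ℂ T with
    lie_mem' := fun {x y} hx hy => by
      change x ∈ Submodule.span ℂ T at hx
      change y ∈ Submodule.span ℂ T at hy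
      change ⁅x, y⁆ ∈ Submodule.span ℂ T
      induction hx using Submodule.span_induction with
      | zero => simp
      | add x x' _ _ h h' => rw [add_lie]; exact add_mem h h'
      | smul c x _ h => rw [smul_lie]; exact Submodule.smul_mem _ _ h
      | mem x hx =>
        induction hy using Submodule.span_induction with
        | zero => simp
        | add x x' _ _ h h' => rw [lie_add]; exact add_mem h h'
        | smul c x _ h => rw [lie_smul]; exact Submodule.smul_mem _ _ h
        | mem y hy => exact h x hx y hy }

theorem size_edgeTree : size edgeTree = 2 := by
  rw [edgeTree, size_mk]
  simp [sz_node]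

theorem size_cherryTree : size cherryTree = 3 := by
  rw [cherryTree, size_mk]
  simp [sz_node]

/-- By size r would be a single vertex, and grafting onto it gives a root with one child, whereas
the root of the cherry has two. -/
theorem beta_cherryTree_edgeTree (r : RTree) : beta cherryTree edgeTree r = 0 := by
  by_contra h
  have h1 := size_add_of_beta h
  rw [size_cherryTree, size_edgeTree] at h1
  obtain ⟨v, hv⟩ := Set.nonempty_of_ncard_ne_zero h
  rw [Set.mem_ofPred_eq] at hv
  have hr : sz r.rep = 1 := by rw [← size_mk, mk_rep]; omega
  generalize r.rep = s at v hv hr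
  have hpos : ∀ t : PTree, 1 ≤ sz t := fun t => size_mk t ▸ one_le_size _
  cases v with
  | @root n c =>
    rw [sz_node] at hr
    have : n ≤ ∑ i, sz (c i) := by
      simpa using Finset.sum_le_sum (s := Finset.univ) fun i _ => hpos (c i)
    obtain rfl : n = 0 := by omega
    rw [cherryTree, graft, mk_eq] at hv
    cases hv with
    | node σ _ => simpa using Fintype.card_congr σ
  | @child n c i v =>
    rw [sz_node] at hr
    have := Finset.single_le_sum (f := fun i => sz (c i)) (fun _ _ => Nat.zero_le _)
      (Finset.mem_univ i)
    have := hpos (c i)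
    omega

/-- The α-terms vanish because a tree with three vertices cannot be cut off one with two. -/
theorem lie_Dp_edgeTree_Dm_cherryTree : ⁅Dp edgeTree, Dm cherryTree⁆ = 0 := by
  have hne : cherryTree ≠ edgeTree := fun h => by
    have := size_cherryTree
    rw [h, size_edgeTree] at this
    omega
  have h : ∀ r, alpha cherryTree edgeTree r = 0 := fun r => by
    by_contra h
    have := size_add_of_alpha h
    rw [size_cherryTree, size_edgeTree] at this
    omega
  rw [← lie_skew, lie_Dm_Dp hne]
  simp [h, beta_cherryTree_edgeTree]

theorem Dp_mem_wt (t : RTree) : Dp t ∈ wt (size t) := basis_mem_wt (Idx.plus t)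
theorem Dm_mem_wt (t : RTree) : Dm t ∈ wt (-(size t : ℤ)) := basis_mem_wt (Idx.minus t)

theorem linearIndependent_edgeTree_cherryTree :
    LinearIndependent ℂ ![Dp edgeTree, d, Dm cherryTree] :=
  linearIndependent_triple (by rw [size_edgeTree]; norm_num) (by rw [size_cherryTree]; norm_num)
    (Dp_mem_wt _) (Dm_mem_wt _) (basis.ne_zero _) (basis.ne_zero _)

theorem exists_abelian :
    ∃ s : LieSubalgebra ℂ Alg, finrank ℂ s = 2 ∧ IsLieAbelian s := by
  have h0 := lie_Dp_edgeTree_Dm_cherryTree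
  have h0' : ⁅Dm cherryTree, Dp edgeTree⁆ = 0 := by rw [← lie_skew, h0, neg_zero]
  refine ⟨spanSubalgebra {Dp edgeTree, Dm cherryTree} ?_, ?_, ?_⟩
  · rintro _ (rfl | rfl) _ (rfl | rfl) <;> simp [h0, h0']
  · have h2 := linearIndependent_edgeTree_cherryTree.comp ![0, 2] (by decide)
    have h3 : ![Dp edgeTree, d, Dm cherryTree] ∘ ![0, 2] = ![Dp edgeTree, Dm cherryTree] := by
      ext i; fin_cases i <;> rfl
    rw [h3] at h2
    exact finrank_span_pair h2
  · refine ⟨?_⟩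
    rintro ⟨u, hu⟩ ⟨v, hv⟩
    obtain ⟨a, b, rfl⟩ := Submodule.mem_span_pair.1 hu
    obtain ⟨a', b', rfl⟩ := Submodule.mem_span_pair.1 hv
    refine Subtype.ext ?_
    change ⁅a • Dp edgeTree + b • Dm cherryTree, a' • Dp edgeTree + b' • Dm cherryTree⁆ = 0
    simp [h0, h0']

theorem exists_nonabelian :
    ∃ s : LieSubalgebra ℂ Alg, finrank ℂ s = 2 ∧ ¬ IsLieAbelian s := by
  have hm : Dp edgeTree ∈ Submodule.span ℂ {Dp edgeTree, d} := Submodule.subset_span (.inl rfl)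
  have h0 : ⁅d, Dp edgeTree⁆ = (2 : ℂ) • Dp edgeTree := by
    rw [lie_d_Dp, size_edgeTree]; norm_num
  refine ⟨spanSubalgebra {Dp edgeTree, d} ?_, ?_, fun h => ?_⟩
  · rintro _ (rfl | rfl) _ (rfl | rfl)
    · rw [lie_self]; exact zero_mem _
    · rw [← lie_skew, h0]; exact neg_mem (Submodule.smul_mem _ _ hm)
    · rw [h0]; exact Submodule.smul_mem _ _ hm
    · rw [lie_self]; exact zero_mem _
  · have h2 := linearIndependent_edgeTree_cherryTree.comp ![0, 1] (by decide)
    have h3 : ![Dp edgeTree, d, Dm cherryTree] ∘ ![0, 1] = ![Dp edgeTree, d] := by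
      ext i; fin_cases i <;> rfl
    rw [h3] at h2
    exact finrank_span_pair h2
  · have := congrArg Subtype.val
      (h.trivial ⟨d, Submodule.subset_span (.inr rfl)⟩ ⟨Dp edgeTree, hm⟩)
    change ⁅d, Dp edgeTree⁆ = 0 at this
    rw [h0] at this
    exact (smul_ne_zero two_ne_zero (basis.ne_zero _)) this

theorem exists_three_dim :
    ∃ s : LieSubalgebra ℂ Alg, finrank ℂ s = 3 ∧
      s.toSubmodule = Submodule.span ℂ {Dp edgeTree, d, Dm cherryTree} := by
  have h0 := lie_Dp_edgeTree_Dm_cherryTree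
  have h1 : Dp edgeTree ∈ Submodule.span ℂ {Dp edgeTree, d, Dm cherryTree} :=
    Submodule.subset_span (.inl rfl)
  have h2 : Dm cherryTree ∈ Submodule.span ℂ {Dp edgeTree, d, Dm cherryTree} :=
    Submodule.subset_span (.inr (.inr rfl))
  refine ⟨spanSubalgebra {Dp edgeTree, d, Dm cherryTree} ?_,
    finrank_span_triple linearIndependent_edgeTree_cherryTree, rfl⟩
  have h3 : ⁅d, Dp edgeTree⁆ ∈ Submodule.span ℂ {Dp edgeTree, d, Dm cherryTree} := by
    rw [lie_d_Dp]; exact Submodule.smul_mem _ _ h1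
  have h4 : ⁅d, Dm cherryTree⁆ ∈ Submodule.span ℂ {Dp edgeTree, d, Dm cherryTree} := by
    rw [lie_d_Dm]; exact Submodule.smul_mem _ _ h2
  rintro _ (rfl | rfl | rfl) _ (rfl | rfl | rfl)
  · rw [lie_self]; exact zero_mem _
  · rw [← lie_skew]; exact neg_mem h3
  · rw [h0]; exact zero_mem _
  · exact h3
  · rw [lie_self]; exact zero_mem _
  · exact h4
  · rw [← lie_skew, h0, neg_zero]; exact zero_mem _
  · rw [← lie_skew]; exact neg_mem h4
  · rw [lie_self]; exact zero_mem _

end InsElim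

end

theorem mainTheorem11 :
    (∀ s : LieSubalgebra ℂ InsElim.Alg, FiniteDimensional ℂ s →
      (Module.finrank ℂ s ≤ 2 ∨
        (Module.finrank ℂ s = 3 ∧
          ∃ m n : ℤ, 0 < m ∧ 0 < n ∧ ∃ x ∈ InsElim.wt m, ∃ y ∈ InsElim.wt (-n),
            LinearIndependent ℂ ![x, InsElim.d, y] ∧
            s.toSubmodule = Submodule.span ℂ {x, InsElim.d, y})) ∧
      (Module.finrank ℂ s = 3 →
        ∀ m n : ℤ, 0 < m → 0 < n → ∀ x ∈ InsElim.wt m, ∀ y ∈ InsElim.wt (-n),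
          LinearIndependent ℂ ![x, InsElim.d, y] →
          s.toSubmodule = Submodule.span ℂ {x, InsElim.d, y} →
          (⁅x, y⁆ = 0 →
            (LieAlgebra.derivedSeries ℂ s 1).toSubmodule.map s.toSubmodule.subtype =
              Submodule.span ℂ {x, y} ∧
            Module.finrank ℂ (LieAlgebra.derivedSeries ℂ s 1) = 2) ∧
          (⁅x, y⁆ ≠ 0 →
            m = n ∧ Nonempty (s ≃ₗ⁅ℂ⁆ LieAlgebra.SpecialLinear.sl (Fin 2) ℂ)))) ∧
    (∃ s : LieSubalgebra ℂ InsElim.Alg, Module.finrank ℂ s = 2 ∧ IsLieAbelian s) ∧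
    (∃ s : LieSubalgebra ℂ InsElim.Alg, Module.finrank ℂ s = 2 ∧ ¬ IsLieAbelian s) ∧
    (⁅InsElim.Dp InsElim.edgeTree, InsElim.Dm InsElim.cherryTree⁆ = 0 ∧
      ∃ s : LieSubalgebra ℂ InsElim.Alg, Module.finrank ℂ s = 3 ∧
        s.toSubmodule = Submodule.span ℂ
          {InsElim.Dp InsElim.edgeTree, InsElim.d, InsElim.Dm InsElim.cherryTree}) := by
  refine ⟨fun s hs => ⟨?_, fun _ m n hm hn x hx y hy hli hspan =>
      ⟨InsElim.derivedSeries_of_lie_eq_zero hm hn hx hy hli hspan,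
        InsElim.nonempty_sl_equiv_of_lie_ne_zero hm hn hx hy hli hspan⟩⟩,
    InsElim.exists_abelian, InsElim.exists_nonabelian,
    InsElim.lie_Dp_edgeTree_Dm_cherryTree, InsElim.exists_three_dim⟩
  have h3 := InsElim.finrank_le_three (ε := 1) (by norm_num) s
  by_cases h : Module.finrank ℂ s = 3
  · exact .inr ⟨h, InsElim.exists_eq_span_triple s h⟩
  · exact .inl (by omega)
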